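/- **Theorem 2.** Let $U\subseteq\mathbb R^3$ be open, with coordinates $(x,y,z)$, and let $A_{22},A_{23},A_{33}$, $B^a_{22},B^a_{23},B^a_{33}$, $C^a_2,C^a_3$, $D^a$ ($a=2,3$) be smooth real functions of $(x,y,z)$ on $U$. Consider the system of two cubically semi-linear ODEs $$\begin{aligned} &y''+A_{22}y'^3+2A_{23}y'^2z'+A_{33}y'z'^2+B^2_{22}y'^2+2B^2_{23}y'z'+B^2_{33}z'^2+C^2_2y'+C^2_3z'+D^2=0,\\ &z''+A_{22}y'^2z'+2A_{23}y'z'^2+A_{33}z'^3+B^3_{22}y'^2+2B^3_{23}y'z'+B^3_{33}z'^2+C^3_2y'+C^3_3z'+D^3=0, \end{aligned}$$ where the prime denotes differentiation with respect to the independent variable $x$ and the superscript on $B^a_{bc},C^a_b,D^a$ is an index. The system is linearizable via point transformations to the simplest system $v''=0$, $w''=0$ (near every point of $U$ there is a smooth, smoothly invertible change of variables $(x,y,z)\mapsto(u,v,w)$, with $u$ the new independent variable, that carries the system to $d^2v/du^2=d^2w/du^2=0$, i.e. whenever it carries the curve of a $C^2$ pair $(y(x),z(x))$ onto the curve of a $C^2$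 pair $(v(u),w(u))$, the former solves the system if and only if the latter solves the simplest system) if and only if the coefficients satisfy on $U$ the following fifteen conditions, in which the letters $x,y,z$ at the end of a subscript denote partial derivatives: $$\begin{aligned} &\text{(1)}\quad \frac12C^3_{2x}-D^3_y+\frac14C^3_3C^3_2+\frac14C^2_2C^3_2-D^2B^3_{22}-D^3B^3_{23}=0,\\ &\text{(2)}\quad B^3_{22x}-\frac12C^3_{2y}-A_{22}D^3+\frac12C^3_2B^2_{22}+\frac12C^3_3B^3_{22}-\frac12C^2_2B^3_{22}-\frac12B^3_{23}C^3_2=0,\\ &\text{(3)}\quad B^3_{23x}-\frac13B^2_{22x}+\frac16C^2_{2y}-\frac43D^3A_{23}-\frac23B^3_{22}C^2_3+\frac2{3}B^2_{23}C^3_2-\frac12C^3_{3y}=0,\\ &\text{(4)}\quad \frac12C^2_{3x}-D^2_z+\frac14C^2_3C^3_3+\frac14C^2_3C^2_2-B^2_{23}D^2-B^2_{33}D^3=0,\\ &\text{(5)}\quad B^2_{33x}-\frac12C^2_{3z}-D^2A_{33}+\frac12C^2_3B^3_{33}-\frac12B^2_{23}C^2_3-\frac12B^2_{33}C^3_3+\frac12B^2_{33}C^2_2=0,\\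 &\text{(6)}\quad -A_{23y}+A_{22z}-A_{22}B^2_{23}-A_{23}B^3_{23}+A_{23}B^2_{22}+A_{33}B^3_{22}=0,\\ &\text{(7)}\quad -A_{33y}+A_{23z}-A_{22}B^2_{33}-A_{23}B^3_{33}+A_{23}B^2_{23}+A_{33}B^3_{23}=0,\\ &\text{(8)}\quad -A_{23x}+\frac5{6}A_{23}C^2_2+\frac13A_{33}C^3_2-\frac13B^3_{23z}+B^2_{33}B^3_{22}+\frac1{6}C^3_3A_{23}-B^2_{23}B^3_{23} -\frac23B^2_{23y}+\frac13B^3_{33y}+\frac23B^2_{22z}-\frac13C^2_3A_{22}=0,\\ &\text{(9)}\quad -A_{33x}+\frac12C^2_2A_{33}+\frac12A_{33}C^3_3-B^2_{33y}+B^2_{23z}-B^2_{22}B^2_{33}+B^2_{23}B^2_{23}-B^2_{23}B^3_{33}+ B^2_{33}B^3_{23}=0,\\ &\text{(10)}\quad -\frac23B^2_{22x}+\frac13C^2_{2y}-\frac12C^3_2B^3_{33}+D^2A_{22}-\frac23D^3A_{23}-\frac13C^2_3B^3_{22}+\frac5{6}B^2_{23}C^3_2 +B^3_{23x}-\frac12C^3_{2z}+\frac12C^3_3B^3_{23}-\frac12C^2_2B^3_{23}=0,\\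 &\text{(11)}\quad -A_{22x}+\frac12C^2_2A_{22}-B^3_{22}B^3_{33}+B^3_{23y}-B^3_{22z}+B^3_{22}B^2_{23}+B^3_{23}B^3_{23}+\frac12C^3_3A_{22}- B^3_{23}B^2_{22}=0,\\ &\text{(12)}\quad D^2_y+B^2_{22}D^2+D^3B^2_{23}-D^3B^3_{33}+\frac12C^3_{3x}-\frac12C^2_{2x}-D^3_z+\frac14C^3_3C^3_3-\frac14C^2_2C^2_2-B^3_{23}D^2=0,\\ &\text{(13)}\quad -2A_{23x}+\frac43B^3_{33y}+\frac13A_{23}C^2_2+\frac53A_{23}C^3_3+\frac23C^2_3A_{22}-\frac43B^3_{23z}-\frac23C^3_2A_{33}+2B^3_{22}B^2_{33} -2B^3_{23}B^2_{23}-\frac23B^2_{23y}+\frac23B^2_{22z}=0,\\ &\text{(14)}\quad B^2_{23x}+\frac12C^2_{3y}-2D^2A_{23}+\frac12C^2_3B^3_{23}+\frac12C^2_3B^2_{22}+\frac12C^3_3B^2_{23}-\frac12B^2_{23}C^2_2-B^2_{33}C^3_2 -C^2_{2z}-D^3A_{33}=0,\\ &\text{(15)}\quad -B^2_{23x}+B^3_{33x}+C^2_{3y}-C^2_3B^3_{23}+C^2_3B^2_{22}+B^2_{23}C^3_3-B^2_{23}C^2_2-\frac12C^3_{3z}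 -\frac12C^2_{2z}-2D^3A_{33}=0.\end{aligned}$$ -/

import Mathlib

open scoped ContDiff

noncomputable section

namespace CubicODE

/-- Partial derivative in the first coordinate `x` of a function of `(x, y, z)`. -/
def dx (f : ℝ × ℝ × ℝ → ℝ) (p : ℝ × ℝ × ℝ) : ℝ := fderiv ℝ f p (1, 0, 0)

/-- Partial derivative in the second coordinate `y`. -/
def dy (f : ℝ × ℝ × ℝ → ℝ) (p : ℝ × ℝ × ℝ) : ℝ := fderiv ℝ f p (0, 1, 0)

/-- Partial derivative in the third coordinate `z`. -/
def dz (f : ℝ × ℝ × ℝ → ℝ) (p : ℝ × ℝ × ℝ) : ℝ := fderiv ℝ f p (0, 0, 1)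

/-- The coefficients, functions of `(x, y, z)`, of a system of two cubically semi-linear
second-order ODEs. `Abc` is `A_{bc}`, `Babc` is `B^a_{bc}`, `Cab` is `C^a_b`, `Da` is `D^a`. -/
structure System where
  A22 : ℝ × ℝ × ℝ → ℝ
  A23 : ℝ × ℝ × ℝ → ℝ
  A33 : ℝ × ℝ × ℝ → ℝ
  B222 : ℝ × ℝ × ℝ → ℝ
  B223 : ℝ × ℝ × ℝ → ℝ
  B233 : ℝ × ℝ × ℝ → ℝ
  B322 : ℝ × ℝ × ℝ → ℝ
  B323 : ℝ × ℝ × ℝ → ℝ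
  B333 : ℝ × ℝ × ℝ → ℝ
  C22 : ℝ × ℝ × ℝ → ℝ
  C23 : ℝ × ℝ × ℝ → ℝ
  C32 : ℝ × ℝ × ℝ → ℝ
  C33 : ℝ × ℝ × ℝ → ℝ
  D2 : ℝ × ℝ × ℝ → ℝ
  D3 : ℝ × ℝ × ℝ → ℝ

/-- All fifteen coefficients are smooth on `U`. -/
def System.SmoothOn (S : System) (U : Set (ℝ × ℝ × ℝ)) : Prop :=
  ContDiffOn ℝ ∞ S.A22 U ∧ ContDiffOn ℝ ∞ S.A23 U ∧ ContDiffOn ℝ ∞ S.A33 U ∧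
  ContDiffOn ℝ ∞ S.B222 U ∧ ContDiffOn ℝ ∞ S.B223 U ∧ ContDiffOn ℝ ∞ S.B233 U ∧
  ContDiffOn ℝ ∞ S.B322 U ∧ ContDiffOn ℝ ∞ S.B323 U ∧ ContDiffOn ℝ ∞ S.B333 U ∧
  ContDiffOn ℝ ∞ S.C22 U ∧ ContDiffOn ℝ ∞ S.C23 U ∧
  ContDiffOn ℝ ∞ S.C32 U ∧ ContDiffOn ℝ ∞ S.C33 U ∧
  ContDiffOn ℝ ∞ S.D2 U ∧ ContDiffOn ℝ ∞ S.D3 U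

/-- `(y, z)` is a (twice continuously differentiable) solution on `I` of the system
`y'' + A₂₂ y'³ + 2 A₂₃ y'² z' + A₃₃ y' z'² + B²₂₂ y'² + 2 B²₂₃ y' z' + B²₃₃ z'²
  + C²₂ y' + C²₃ z' + D² = 0`,
`z'' + A₂₂ y'² z' + 2 A₂₃ y' z'² + A₃₃ z'³ + B³₂₂ y'² + 2 B³₂₃ y' z' + B³₃₃ z'²
  + C³₂ y' + C³₃ z' + D³ = 0`,
the coefficients being evaluated at `(x, y x, z x)`. -/
def System.IsSolutionOn (S : System) (I : Set ℝ) (y z : ℝ → ℝ) : Prop :=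
  ContDiffOn ℝ 2 y I ∧ ContDiffOn ℝ 2 z I ∧
  ∀ x ∈ I,
    (deriv (deriv y) x
      + S.A22 (x, y x, z x) * deriv y x ^ 3
      + 2 * S.A23 (x, y x, z x) * deriv y x ^ 2 * deriv z x
      + S.A33 (x, y x, z x) * deriv y x * deriv z x ^ 2
      + S.B222 (x, y x, z x) * deriv y x ^ 2
      + 2 * S.B223 (x, y x, z x) * deriv y x * deriv z x
      + S.B233 (x, y x, z x) * deriv z x ^ 2
      + S.C22 (x, y x, z x) * deriv y x
      + S.C23 (x, y x, z x) * deriv z x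
      + S.D2 (x, y x, z x) = 0) ∧
    (deriv (deriv z) x
      + S.A22 (x, y x, z x) * deriv y x ^ 2 * deriv z x
      + 2 * S.A23 (x, y x, z x) * deriv y x * deriv z x ^ 2
      + S.A33 (x, y x, z x) * deriv z x ^ 3
      + S.B322 (x, y x, z x) * deriv y x ^ 2
      + 2 * S.B323 (x, y x, z x) * deriv y x * deriv z x
      + S.B333 (x, y x, z x) * deriv z x ^ 2
      + S.C32 (x, y x, z x) * deriv y x
      + S.C33 (x, y x, z x) * deriv z x
      + S.D3 (x, y x, z x) = 0)

/-- `(v, w)` is a solution on `J` of the simplest (free particle) system `v'' = 0`, `w'' = 0`. -/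
def IsFreeSolutionOn (J : Set ℝ) (v w : ℝ → ℝ) : Prop :=
  ContDiffOn ℝ 2 v J ∧ ContDiffOn ℝ 2 w J ∧
  ∀ u ∈ J, deriv (deriv v) u = 0 ∧ deriv (deriv w) u = 0

/-- The curve `{(x, y x, z x) | x ∈ I}`. -/
def curve (I : Set ℝ) (y z : ℝ → ℝ) : Set (ℝ × ℝ × ℝ) := (fun x => (x, y x, z x)) '' I

/-- The invertible change of variables `(u, v, w) = Φ (x, y, z)` carries the system to the simplest
system: whenever `Φ` carries the curve of a `C²` pair `(y, z)` of functions of `x` onto the curve of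
a `C²` pair `(v, w)` of functions of the new independent variable `u`, the pair `(y, z)` solves the
system if and only if `v'' = w'' = 0`. -/
def System.MapsToFree (S : System) (Φ : OpenPartialHomeomorph (ℝ × ℝ × ℝ) (ℝ × ℝ × ℝ)) : Prop :=
  ∀ (I J : Set ℝ) (y z v w : ℝ → ℝ),
    IsOpen I → I.OrdConnected → IsOpen J → J.OrdConnected →
    ContDiffOn ℝ 2 y I → ContDiffOn ℝ 2 z I → ContDiffOn ℝ 2 v J → ContDiffOn ℝ 2 w J →
    curve I y z ⊆ Φ.source → Φ '' curve I y z = curve J v w →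
    (S.IsSolutionOn I y z ↔ IsFreeSolutionOn J v w)

/-- The system, with coefficients given on `U`, is linearizable near `p` by a point transformation
to the simplest system: some smooth, smoothly invertible change of variables defined on an open
neighbourhood of `p` in `U` carries it to the simplest system. -/
def System.LinearizableAt (S : System) (U : Set (ℝ × ℝ × ℝ)) (p : ℝ × ℝ × ℝ) : Prop :=
  ∃ Φ : OpenPartialHomeomorph (ℝ × ℝ × ℝ) (ℝ × ℝ × ℝ),
    p ∈ Φ.source ∧ Φ.source ⊆ U ∧
    ContDiffOn ℝ ∞ Φ Φ.source ∧ ContDiffOn ℝ ∞ Φ.symm Φ.target ∧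
    S.MapsToFree Φ

/-- The fifteen conditions on the coefficients, at the point `p`. -/
def System.FifteenConditions (S : System) (p : ℝ × ℝ × ℝ) : Prop :=
    (1 / 2 * dx S.C32 p - dy S.D3 p + 1 / 4 * S.C33 p * S.C32 p + 1 / 4 * S.C22 p * S.C32 p
      - S.D2 p * S.B322 p - S.D3 p * S.B323 p = 0) ∧
    (dx S.B322 p - 1 / 2 * dy S.C32 p - S.A22 p * S.D3 p + 1 / 2 * S.C32 p * S.B222 p
      + 1 / 2 * S.C33 p * S.B322 p - 1 / 2 * S.C22 p * S.B322 p - 1 / 2 * S.B323 p * S.C32 p = 0) ∧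
    (dx S.B323 p - 1 / 3 * dx S.B222 p + 1 / 6 * dy S.C22 p - 4 / 3 * S.D3 p * S.A23 p
      - 2 / 3 * S.B322 p * S.C23 p + 2 / 3 * S.B223 p * S.C32 p - 1 / 2 * dy S.C33 p = 0) ∧
    (1 / 2 * dx S.C23 p - dz S.D2 p + 1 / 4 * S.C23 p * S.C33 p + 1 / 4 * S.C23 p * S.C22 p
      - S.B223 p * S.D2 p - S.B233 p * S.D3 p = 0) ∧
    (dx S.B233 p - 1 / 2 * dz S.C23 p - S.D2 p * S.A33 p + 1 / 2 * S.C23 p * S.B333 p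
      - 1 / 2 * S.B223 p * S.C23 p - 1 / 2 * S.B233 p * S.C33 p + 1 / 2 * S.B233 p * S.C22 p = 0) ∧
    (-dy S.A23 p + dz S.A22 p - S.A22 p * S.B223 p - S.A23 p * S.B323 p + S.A23 p * S.B222 p
      + S.A33 p * S.B322 p = 0) ∧
    (-dy S.A33 p + dz S.A23 p - S.A22 p * S.B233 p - S.A23 p * S.B333 p + S.A23 p * S.B223 p
      + S.A33 p * S.B323 p = 0) ∧
    (-dx S.A23 p + 5 / 6 * S.A23 p * S.C22 p + 1 / 3 * S.A33 p * S.C32 p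
      - 1 / 3 * dz S.B323 p + S.B233 p * S.B322 p + 1 / 6 * S.C33 p * S.A23 p
      - S.B223 p * S.B323 p - 2 / 3 * dy S.B223 p + 1 / 3 * dy S.B333 p + 2 / 3 * dz S.B222 p
      - 1 / 3 * S.C23 p * S.A22 p = 0) ∧
    (-dx S.A33 p + 1 / 2 * S.C22 p * S.A33 p + 1 / 2 * S.A33 p * S.C33 p - dy S.B233 p
      + dz S.B223 p - S.B222 p * S.B233 p + S.B223 p * S.B223 p - S.B223 p * S.B333 p
      + S.B233 p * S.B323 p = 0) ∧
    (-2 / 3 * dx S.B222 p + 1 / 3 * dy S.C22 p - 1 / 2 * S.C32 p * S.B333 p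
      + S.D2 p * S.A22 p - 2 / 3 * S.D3 p * S.A23 p - 1 / 3 * S.C23 p * S.B322 p
      + 5 / 6 * S.B223 p * S.C32 p + dx S.B323 p - 1 / 2 * dz S.C32 p
      + 1 / 2 * S.C33 p * S.B323 p - 1 / 2 * S.C22 p * S.B323 p = 0) ∧
    (-dx S.A22 p + 1 / 2 * S.C22 p * S.A22 p - S.B322 p * S.B333 p + dy S.B323 p
      - dz S.B322 p + S.B322 p * S.B223 p + S.B323 p * S.B323 p + 1 / 2 * S.C33 p * S.A22 p
      - S.B323 p * S.B222 p = 0) ∧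
    (dy S.D2 p + S.B222 p * S.D2 p + S.D3 p * S.B223 p - S.D3 p * S.B333 p
      + 1 / 2 * dx S.C33 p - 1 / 2 * dx S.C22 p - dz S.D3 p + 1 / 4 * S.C33 p * S.C33 p
      - 1 / 4 * S.C22 p * S.C22 p - S.B323 p * S.D2 p = 0) ∧
    (-2 * dx S.A23 p + 4 / 3 * dy S.B333 p + 1 / 3 * S.A23 p * S.C22 p
      + 5 / 3 * S.A23 p * S.C33 p + 2 / 3 * S.C23 p * S.A22 p - 4 / 3 * dz S.B323 p
      - 2 / 3 * S.C32 p * S.A33 p + 2 * S.B322 p * S.B233 p - 2 * S.B323 p * S.B223 p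
      - 2 / 3 * dy S.B223 p + 2 / 3 * dz S.B222 p = 0) ∧
    (dx S.B223 p + 1 / 2 * dy S.C23 p - 2 * S.D2 p * S.A23 p + 1 / 2 * S.C23 p * S.B323 p
      + 1 / 2 * S.C23 p * S.B222 p + 1 / 2 * S.C33 p * S.B223 p - 1 / 2 * S.B223 p * S.C22 p
      - S.B233 p * S.C32 p - dz S.C22 p - S.D3 p * S.A33 p = 0) ∧
    (-dx S.B223 p + dx S.B333 p + dy S.C23 p - S.C23 p * S.B323 p + S.C23 p * S.B222 p
      + S.B223 p * S.C33 p - S.B223 p * S.C22 p - 1 / 2 * dz S.C33 p - 1 / 2 * dz S.C22 p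
      - 2 * S.D3 p * S.A33 p = 0)

end CubicODE

end

/-!
The solutions of the system, as curves in the space of `(x, y, z)`, are the unparametrized geodesics
of a torsion-free connection, which is determined up to a projective change
`Γ^l_{ij} ↦ Γ^l_{ij} + δ^l_i ψ_j + δ^l_j ψ_i`; `System.IsRepresentedBy` expresses the coefficients
through its Christoffel symbols. Point transformations are changes of coordinates, and the simplest
system belongs to the flat connection, whose geodesics are the straight lines. So the theorem
characterizes projectively flat connections in dimension three, and the fifteen conditions say that
Weyl's projective curvature tensor vanishes.

If the system is linearized by `Φ`, pull the flat connection back by `Φ`. Testing the hypothesis on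
the preimages of straight lines shows that the pulled-back connection represents the system
(`System.MapsToFree.isRepresentedBy`). It is flat (`curv_pullbackSymbol`), and each of the fifteen
expressions is a linear combination of components of the curvature
(`System.fifteenConditions_of_curv_eq_zero`).

Conversely, the trace-free connection `System.christoffel` represents the system, and the conditions
say that its curvature is `δ^l_i P_{jk} - δ^l_j P_{ik}`, with `P` half the Ricci tensor
(`System.FifteenConditions.curv_eq`). The Bianchi identity then forces the Cotton tensor, the
alternated covariant derivative of `P`, to vanish (`cotton_eq_zero`). Together these are the
integrability conditions of the linear system `∂ᵢ ∂ⱼ σ = ∑ l, Γ^l_{ij} ∂ₗ σ - P_{ij} σ` for a single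
function (`tractor_compatible`), so by Frobenius' theorem (`exists_fundamental_matrix`) it has near
each point four solutions with arbitrary initial values of `(σ, ∂σ)`. Quotients of three of them by
the fourth have vanishing Hessian for a projectively equivalent connection
(`exists_affine_coordinates`), hence are coordinates in which the geodesics are straight lines.
-/

namespace CubicODE

open Set Metric Filter Topology

/-! ### Frobenius' theorem for linear systems -/

section Frobenius

variable {E F : Type*} [NormedAddCommGroup E] [NormedSpace ℝ E]

/-- Grönwall's inequality on `[0, 1]`, with the constant `e ≤ 3`. -/
lemma norm_le_of_norm_deriv_le [NormedAddCommGroup F] [NormedSpace ℝ F]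
    {f f' : ℝ → F} {ε : ℝ} (hε : 0 ≤ ε)
    (hf : ∀ t ∈ Icc (0 : ℝ) 1, HasDerivWithinAt f (f' t) (Icc 0 1) t)
    (hb : ∀ t ∈ Icc (0 : ℝ) 1, ‖f' t‖ ≤ ‖f t‖ + ε) :
    ∀ t ∈ Icc (0 : ℝ) 1, ‖f t‖ ≤ 3 * (‖f 0‖ + ε) := by
  intro t ht
  have h := norm_le_gronwallBound_of_norm_deriv_right_le (f := f) (f' := f') (δ := ‖f 0‖)
    (K := 1) (ε := ε) (a := 0) (b := 1) (fun t ht => (hf t ht).continuousWithinAt)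
    (fun t ht => (hf t ⟨ht.1, ht.2.le⟩).mono_of_mem_nhdsWithin (Icc_mem_nhdsGE_of_mem ht))
    le_rfl (fun t ht => by simpa using hb t ⟨ht.1, ht.2.le⟩) t ht
  rw [gronwallBound_of_K_ne_0 one_ne_zero] at h
  have he : Real.exp t ≤ 3 :=
    (Real.exp_le_exp.2 ht.2).trans (Real.exp_one_lt_d9.le.trans (by norm_num))
  have h0 := norm_nonneg (f 0)
  simp only [sub_zero, one_mul, div_one] at h
  nlinarith

variable [NormedRing F]

lemma norm_mul_le_of_le_of_le {x y : F} {a b : ℝ} (hx : ‖x‖ ≤ a) (hy : ‖y‖ ≤ b) :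
    ‖x * y‖ ≤ a * b :=
  (norm_mul_le x y).trans (mul_le_mul hx hy (norm_nonneg _) ((norm_nonneg _).trans hx))

variable [NormedAlgebra ℝ F]

/-- A linear differential equation on `[0, 1]` whose coefficient has norm at most `1 / 2` has a
solution with prescribed initial value. -/
lemma exists_linear_solution [CompleteSpace F] {A : ℝ → F}
    (hA : ContinuousOn A (Icc 0 1)) (hb : ∀ t ∈ Icc (0 : ℝ) 1, ‖A t‖ ≤ 1 / 2) (x₀ : F) :
    ∃ x : ℝ → F, x 0 = x₀ ∧
      ∀ t ∈ Icc (0 : ℝ) 1, HasDerivWithinAt x (A t * x t) (Icc 0 1) t := by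
  have h : IsPicardLindelof (fun t x => A t * x) (⟨0, by simp⟩ : Icc (0 : ℝ) 1) x₀ ‖x₀‖₊ 0 ‖x₀‖₊
      (1 / 2) := by
    refine ⟨fun t ht => ?_, fun x _ => ?_, fun t ht x hx => ?_, ?_⟩
    · refine LipschitzOnWith.of_dist_le_mul fun x _ y _ => ?_
      rw [dist_eq_norm, dist_eq_norm, ← mul_sub]
      simpa using norm_mul_le_of_le_of_le (hb t ht) (le_refl ‖x - y‖)
    · exact hA.mul continuousOn_const
    · have h1 := norm_mul_le_of_le_of_le (hb t ht) (le_refl ‖x‖)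
      have h2 : ‖x‖ ≤ ‖x₀‖ + ‖x₀‖ := by
        rw [mem_closedBall_iff_norm] at hx
        have := norm_le_norm_add_norm_sub x₀ x
        rw [norm_sub_rev] at this
        simp only [coe_nnnorm] at hx
        linarith
      simp only [coe_nnnorm]
      linarith
    · simp
  exact h.exists_eq_forall_mem_Icc_hasDerivWithinAt₀

/-- **Frobenius' theorem** for a flat linear system `D X (q) h = M q h * X q`, with the smallness
assumptions on the ball made explicit. The solution is obtained by solving the system along rays
from the centre; flatness makes the candidate `M q h * X q` for the derivative satisfy, along a
ray, the variational equation up to an error of order `‖h‖ ^ 2`. -/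
theorem exists_hasFDerivAt_of_flat_of_bounds [CompleteSpace F] {M : E → E →L[ℝ] F}
    {M' : E → E →L[ℝ] E →L[ℝ] F} {p : E} {r C : ℝ} (hr : 0 < r) (hr1 : r ≤ 1)
    (hC : 1 ≤ C) (hrC : C * r ≤ 1 / 2)
    (hM : ∀ q ∈ ball p r, HasFDerivAt M (M' q) q)
    (hb : ∀ q ∈ ball p r, ‖M q‖ ≤ C) (hb' : ∀ q ∈ ball p r, ‖M' q‖ ≤ C)
    (hl : ∀ q ∈ ball p r, ∀ q' ∈ ball p r, ‖M' q - M' q'‖ ≤ C * ‖q - q'‖)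
    (hflat : ∀ q ∈ ball p r, ∀ h k, M' q h k + M q k * M q h = M' q k h + M q h * M q k)
    (x₀ : F) :
    ∃ X : E → F, X p = x₀ ∧
      ∀ q ∈ ball p r, HasFDerivAt X ((ContinuousLinearMap.mul ℝ F).flip (X q) ∘L M q) q := by
  have hC0 : 0 < C := by linarith
  have hray : ∀ q ∈ ball p r, ∀ t ∈ Icc (0 : ℝ) 1, p + t • (q - p) ∈ ball p r := by
    intro q hq t ht
    rw [mem_ball_iff_norm] at hq ⊢
    simp only [add_sub_cancel_left, norm_smul, Real.norm_eq_abs, abs_of_nonneg ht.1]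
    nlinarith [ht.2, norm_nonneg (q - p)]
  have hder : ∀ q ∈ ball p r, ∀ t ∈ Icc (0 : ℝ) 1,
      HasDerivWithinAt (fun t => M (p + t • (q - p))) (M' (p + t • (q - p)) (q - p))
        (Icc 0 1) t := by
    intro q hq t ht
    have h1 : HasDerivAt (fun t : ℝ => p + t • (q - p)) (q - p) t := by
      simpa using ((hasDerivAt_id t).smul_const (q - p)).const_add p
    exact ((hM _ (hray q hq t ht)).comp_hasDerivAt t h1).hasDerivWithinAt
  have hA : ∀ q ∈ ball p r, ∀ t ∈ Icc (0 : ℝ) 1, ‖M (p + t • (q - p)) (q - p)‖ ≤ 1 / 2 := by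
    intro q hq t ht
    have h1 := (M (p + t • (q - p))).le_of_opNorm_le (hb _ (hray q hq t ht)) (q - p)
    rw [mem_ball_iff_norm] at hq
    nlinarith
  have hex : ∀ q, ∃ x : ℝ → F, q ∈ ball p r → x 0 = x₀ ∧ ∀ t ∈ Icc (0 : ℝ) 1,
      HasDerivWithinAt x (M (p + t • (q - p)) (q - p) * x t) (Icc 0 1) t := by
    intro q
    by_cases hq : q ∈ ball p r
    · obtain ⟨x, hx⟩ := exists_linear_solution (A := fun t => M (p + t • (q - p)) (q - p))
        (fun t ht => ((hder q hq t ht).continuousWithinAt).clm_apply continuousWithinAt_const)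
        (hA q hq) x₀
      exact ⟨x, fun _ => hx⟩
    · exact ⟨fun _ => 0, fun h => absurd h hq⟩
  choose x hx using hex
  have hxb : ∀ q ∈ ball p r, ∀ t ∈ Icc (0 : ℝ) 1, ‖x q t‖ ≤ 3 * ‖x₀‖ := by
    intro q hq t ht
    have := norm_le_of_norm_deriv_le le_rfl (hx q hq).2 (fun t ht => by
      have := norm_mul_le_of_le_of_le (hA q hq t ht) (le_refl ‖x q t‖)
      have := norm_nonneg (x q t)
      linarith) t ht
    simpa [(hx q hq).1] using this
  obtain ⟨B, hB⟩ : ∃ B, B = 3 * ‖x₀‖ := ⟨_, rfl⟩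
  rw [← hB] at hxb
  have hB0 : 0 ≤ B := by rw [hB]; positivity
  have hpp : p ∈ ball p r := mem_ball_self hr
  refine ⟨fun q => x q 1, ?_, fun q hq => ?_⟩
  · have := norm_le_of_norm_deriv_le (f := fun t => x p t - x₀) (f' := fun _ => 0) le_rfl
      (fun t ht => by simpa using ((hx p hpp).2 t ht).sub_const x₀)
      (fun t _ => by simp) 1 (by simp)
    simp only [(hx p hpp).1] at this
    simpa [sub_eq_zero] using this
  -- Second-order estimate for the increment of the solution.
  have key : ∀ h : E, q + h ∈ ball p r →
      ‖x (q + h) 1 - x q 1 - M q h * x q 1‖ ≤ (3 * (12 * C * C * B + 2 * C * B)) * ‖h‖ ^ 2 := by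
    intro h hqh
    obtain ⟨b, hbdef⟩ : ∃ b, b = q - p := ⟨_, rfl⟩
    have hqh' : q + h - p = b + h := by rw [hbdef]; abel
    have hbr : ‖b‖ ≤ r := by rw [hbdef]; exact (mem_ball_iff_norm.1 hq).le
    have hh0 := norm_nonneg h
    have hpt : ∀ t : ℝ, p + t • (b + h) = p + t • b + t • h := by
      intro t
      rw [smul_add, add_assoc]
    have hxq := (hx q hq).2
    have hxh := (hx (q + h) hqh).2
    have hAq := hA q hq
    have hAh := hA (q + h) hqh
    have hm0 := hray q hq
    have hm1 := hray (q + h) hqh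
    have hdq := hder q hq
    simp only [hqh', hpt] at hxh hAh hm1
    simp only [← hbdef] at hxq hAq hm0 hdq
    have hth : ∀ t ∈ Icc (0 : ℝ) 1, ‖t • h‖ ≤ ‖h‖ := by
      intro t ht
      rw [norm_smul, Real.norm_eq_abs, abs_of_nonneg ht.1]
      nlinarith [ht.2]
    have hM1 : ∀ t ∈ Icc (0 : ℝ) 1, ‖M (p + t • b + t • h) - M (p + t • b)‖ ≤ C * ‖h‖ := by
      intro t ht
      have := Convex.norm_image_sub_le_of_norm_hasFDerivWithin_le
        (fun z hz => (hM z hz).hasFDerivWithinAt) hb' (convex_ball p r) (hm0 t ht) (hm1 t ht)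
      simp only [add_sub_cancel_left] at this
      nlinarith [hth t ht]
    have hM2 : ∀ t ∈ Icc (0 : ℝ) 1, ‖M (p + t • b + t • h) - M (p + t • b)
        - t • M' (p + t • b) h‖ ≤ C * ‖h‖ ^ 2 := by
      intro t ht
      have hseg : segment ℝ (p + t • b) (p + t • b + t • h) ⊆ ball p r :=
        (convex_ball p r).segment_subset (hm0 t ht) (hm1 t ht)
      have := Convex.norm_image_sub_le_of_norm_hasFDerivWithin_le'
        (fun z hz => (hM z (hseg hz)).hasFDerivWithinAt) (C := C * ‖h‖)
        (φ := M' (p + t • b)) (fun z hz => by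
          refine (hl z (hseg hz) _ (hm0 t ht)).trans ?_
          have h1 := norm_sub_le_of_mem_segment hz
          have h2 := hth t ht
          simp only [add_sub_cancel_left] at h1
          exact mul_le_mul_of_nonneg_left (h1.trans h2) hC0.le)
        (convex_segment _ _) (left_mem_segment ℝ _ _) (right_mem_segment ℝ _ _)
      simp only [add_sub_cancel_left, map_smul] at this
      have h2 := mul_le_mul_of_nonneg_left (hth t ht) (mul_nonneg hC0.le hh0)
      exact this.trans (h2.trans (by rw [pow_two, mul_assoc]))
    have hdA : ∀ t ∈ Icc (0 : ℝ) 1,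
        ‖M (p + t • b + t • h) (b + h) - M (p + t • b) b‖ ≤ 2 * C * ‖h‖ := by
      intro t ht
      have e : M (p + t • b + t • h) (b + h) - M (p + t • b) b
          = (M (p + t • b + t • h) - M (p + t • b)) b + M (p + t • b + t • h) h := by
        simp only [map_add, sub_apply]; abel
      rw [e]
      have h1 := (M (p + t • b + t • h) - M (p + t • b)).le_of_opNorm_le (hM1 t ht) b
      have h2 := (M (p + t • b + t • h)).le_of_opNorm_le (hb _ (hm1 t ht)) h
      have h3 := norm_add_le ((M (p + t • b + t • h) - M (p + t • b)) b)
        (M (p + t • b + t • h) h)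
      have h4 : C * ‖h‖ * ‖b‖ ≤ C * ‖h‖ * 1 := by gcongr; linarith
      linarith
    have hddA : ∀ t ∈ Icc (0 : ℝ) 1,
        ‖M (p + t • b + t • h) (b + h) - M (p + t • b) b - M (p + t • b) h
          - t • M' (p + t • b) h b‖ ≤ 2 * C * ‖h‖ ^ 2 := by
      intro t ht
      have e : M (p + t • b + t • h) (b + h) - M (p + t • b) b - M (p + t • b) h
          - t • M' (p + t • b) h b
          = (M (p + t • b + t • h) - M (p + t • b) - t • M' (p + t • b) h) b
            + (M (p + t • b + t • h) - M (p + t • b)) h := by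
        simp only [map_add, sub_apply, smul_apply]; abel
      rw [e]
      have h1 := (M (p + t • b + t • h) - M (p + t • b)
        - t • M' (p + t • b) h).le_of_opNorm_le (hM2 t ht) b
      have h2 := (M (p + t • b + t • h) - M (p + t • b)).le_of_opNorm_le (hM1 t ht) h
      have h3 := norm_add_le
        ((M (p + t • b + t • h) - M (p + t • b) - t • M' (p + t • b) h) b)
        ((M (p + t • b + t • h) - M (p + t • b)) h)
      have h4 : C * ‖h‖ ^ 2 * ‖b‖ ≤ C * ‖h‖ ^ 2 * 1 := by gcongr; linarith
      nlinarith
    -- First-order estimate.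
    have hΔ : ∀ t ∈ Icc (0 : ℝ) 1, ‖x (q + h) t - x q t‖ ≤ 3 * (2 * C * ‖h‖ * B) := by
      intro t ht
      have := norm_le_of_norm_deriv_le (ε := 2 * C * ‖h‖ * B) (by positivity)
        (f := fun t => x (q + h) t - x q t)
        (fun t ht => (hxh t ht).sub (hxq t ht)) (fun t ht => by
          have e : M (p + t • b + t • h) (b + h) * x (q + h) t - M (p + t • b) b * x q t
              = M (p + t • b + t • h) (b + h) * (x (q + h) t - x q t)
                + (M (p + t • b + t • h) (b + h) - M (p + t • b) b) * x q t := by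
            noncomm_ring
          rw [e]
          refine (norm_add_le _ _).trans ?_
          have h1 := norm_mul_le_of_le_of_le (hAh t ht) (le_refl ‖x (q + h) t - x q t‖)
          have h2 := norm_mul_le_of_le_of_le (hdA t ht) (hxb q hq t ht)
          have h3 := norm_nonneg (x (q + h) t - x q t)
          linarith) t ht
      simpa [(hx q hq).1, (hx (q + h) hqh).1] using this
    have hE := norm_le_of_norm_deriv_le (ε := (12 * C * C * B + 2 * C * B) * ‖h‖ ^ 2)
      (by positivity)
      (f := fun t => x (q + h) t - x q t - t • (M (p + t • b) h * x q t))
      (f' := fun t => M (p + t • b) b * (x (q + h) t - x q t - t • (M (p + t • b) h * x q t))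
        + (M (p + t • b + t • h) (b + h) - M (p + t • b) b - M (p + t • b) h
          - t • M' (p + t • b) h b) * x q t
        + (M (p + t • b + t • h) (b + h) - M (p + t • b) b) * (x (q + h) t - x q t))
      (fun t ht => by
        have h1 := (hdq t ht).clm_apply (hasDerivWithinAt_const t (Icc 0 1) h)
        have h2 := h1.mul (hxq t ht)
        have h3 := (hasDerivWithinAt_id t (Icc (0 : ℝ) 1)).smul h2
        refine (((hxh t ht).sub (hxq t ht)).sub h3).congr_deriv ?_
        have hf : M' (p + t • b) b h = M' (p + t • b) h b + M (p + t • b) b * M (p + t • b) h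
            - M (p + t • b) h * M (p + t • b) b := by
          rw [eq_sub_iff_add_eq, ← hflat _ (hm0 t ht) h b]
        simp only [map_zero, add_zero, id, one_smul, hf, mul_sub, sub_mul, add_mul,
          mul_smul_comm, smul_mul_assoc, smul_add, smul_sub, mul_assoc]
        abel)
      (fun t ht => by
        refine (norm_add₃_le).trans ?_
        have h1 := norm_mul_le_of_le_of_le (hAq t ht)
          (le_refl ‖x (q + h) t - x q t - t • (M (p + t • b) h * x q t)‖)
        have h2 := norm_mul_le_of_le_of_le (hddA t ht) (hxb q hq t ht)
        have h3 := norm_mul_le_of_le_of_le (hdA t ht) (hΔ t ht)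
        have h4 := norm_nonneg (x (q + h) t - x q t - t • (M (p + t • b) h * x q t))
        have h5 : 0 ≤ C * C * B * ‖h‖ ^ 2 := by positivity
        linarith) 1 (by simp)
    simp only [one_smul, (hx q hq).1, (hx (q + h) hqh).1, zero_smul, sub_self, norm_zero,
      zero_add] at hE
    rw [show p + b = q by rw [hbdef]; abel] at hE
    linarith
  rw [hasFDerivAt_iff_isLittleO_nhds_zero]
  have hO : (fun h => x (q + h) 1 - x q 1
      - ((ContinuousLinearMap.mul ℝ F).flip (x q 1) ∘L M q) h) =O[𝓝 0] fun h => ‖h‖ ^ 2 := by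
    refine Asymptotics.IsBigO.of_bound (3 * (12 * C * C * B + 2 * C * B)) ?_
    have : ∀ᶠ h in 𝓝 (0 : E), q + h ∈ ball p r := by
      have hc : ContinuousAt (fun h : E => q + h) 0 := by fun_prop
      exact hc.eventually (by simp only [add_zero]; exact isOpen_ball.mem_nhds hq)
    filter_upwards [this] with h hh
    simpa using key h hh
  refine hO.trans_isLittleO ?_
  exact Asymptotics.isLittleO_norm_pow_id (E' := E) (n := 2) (by norm_num)

/-- **Frobenius' theorem** for linear systems: a smooth system `D X (q) h = M q h * X q` that
satisfies the compatibility condition on an open set has, near each point, a smooth solution with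
prescribed initial value. -/
theorem exists_hasFDerivAt_of_flat [CompleteSpace F] {M : E → E →L[ℝ] F} {U : Set E}
    (hU : IsOpen U) (hM : ContDiffOn ℝ ∞ M U)
    (hflat : ∀ q ∈ U, ∀ h k, fderiv ℝ M q h k + M q k * M q h =
      fderiv ℝ M q k h + M q h * M q k) {p : E} (hp : p ∈ U) (x₀ : F) :
    ∃ X : E → F, ∃ V : Set E, IsOpen V ∧ p ∈ V ∧ V ⊆ U ∧ X p = x₀ ∧ ContDiffOn ℝ ∞ X V ∧
      ∀ q ∈ V, HasFDerivAt X ((ContinuousLinearMap.mul ℝ F).flip (X q) ∘L M q) q := by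
  have hMp : ContDiffAt ℝ ∞ M p := hM.contDiffAt (hU.mem_nhds hp)
  have hM'p : ContDiffAt ℝ 1 (fderiv ℝ M) p :=
    (contDiffAt_infty.1 hMp 2).fderiv_right (m := 1) (by norm_num)
  obtain ⟨K, T, hT, hK⟩ := hM'p.exists_lipschitzOnWith
  have hev : ∀ᶠ q in 𝓝 p, q ∈ U ∧ q ∈ T ∧ ‖M q‖ < ‖M p‖ + 1 :=
    (show ∀ᶠ q in 𝓝 p, q ∈ U from hU.mem_nhds hp).and <|
      (show ∀ᶠ q in 𝓝 p, q ∈ T from hT).and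
        (hMp.continuousAt.norm.eventually_lt_const (lt_add_one _))
  obtain ⟨r₀, hr₀, hball⟩ := Metric.eventually_nhds_iff_ball.1 hev
  obtain ⟨C, hC⟩ : ∃ C, C = ‖M p‖ + ‖fderiv ℝ M p‖ + K + 1 := ⟨_, rfl⟩
  have h1 := norm_nonneg (M p)
  have h2 := norm_nonneg (fderiv ℝ M p)
  have h3 := K.coe_nonneg
  have hC1 : 1 ≤ C := by linarith
  obtain ⟨r, hr⟩ : ∃ r, r = min r₀ (1 / (2 * C)) := ⟨_, rfl⟩
  have hr0 : 0 < r := by rw [hr]; positivity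
  have hrr : r ≤ r₀ := by rw [hr]; exact min_le_left _ _
  have hrC : r ≤ 1 / (2 * C) := by rw [hr]; exact min_le_right _ _
  rw [le_div_iff₀ (by positivity)] at hrC
  have hb : ∀ q ∈ ball p r, q ∈ U ∧ q ∈ T ∧ ‖M q‖ < ‖M p‖ + 1 :=
    fun q hq => hball q (ball_subset_ball hrr hq)
  obtain ⟨X, hXp, hX⟩ := exists_hasFDerivAt_of_flat_of_bounds (M := M) (M' := fderiv ℝ M)
    (p := p) (C := C) hr0 (by nlinarith) hC1 (by nlinarith)
    (fun q hq => ((hM.contDiffAt (hU.mem_nhds (hb q hq).1)).differentiableAt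
      (by simp)).hasFDerivAt)
    (fun q hq => by linarith [(hb q hq).2.2])
    (fun q hq => by
      have h4 := hK.dist_le_mul q (hb q hq).2.1 p (mem_of_mem_nhds hT)
      have h5 : dist q p ≤ 1 := (mem_ball.1 hq).le.trans (by nlinarith)
      rw [dist_eq_norm (fderiv ℝ M q)] at h4
      have h6 := norm_le_norm_add_norm_sub (fderiv ℝ M p) (fderiv ℝ M q)
      rw [norm_sub_rev] at h6
      nlinarith)
    (fun q hq q' hq' => by
      have := hK.dist_le_mul q (hb q hq).2.1 q' (hb q' hq').2.1
      rw [dist_eq_norm, dist_eq_norm] at this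
      exact this.trans (by gcongr; linarith))
    (fun q hq => hflat q (hb q hq).1) x₀
  refine ⟨X, ball p r, isOpen_ball, mem_ball_self hr0, fun q hq => (hb q hq).1, hXp, ?_, hX⟩
  have hMb : ContDiffOn ℝ ∞ M (ball p r) := hM.mono fun q hq => (hb q hq).1
  rw [contDiffOn_infty]
  intro n
  induction n with
  | zero => exact contDiffOn_zero.2 fun q hq => (hX q hq).continuousAt.continuousWithinAt
  | succ n ih =>
    rw [Nat.cast_add, Nat.cast_one, contDiffOn_succ_iff_fderiv_of_isOpen isOpen_ball]
    refine ⟨fun q hq => (hX q hq).differentiableAt.differentiableWithinAt, by simp, ?_⟩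
    refine ContDiffOn.congr ?_ fun q hq => (hX q hq).fderiv
    exact ((ContinuousLinearMap.mul ℝ F).flip.contDiff.comp_contDiffOn ih).clm_comp
      (hMb.of_le (by exact_mod_cast le_top))

end Frobenius

/-! ### Partial derivatives on `ℝ × ℝ × ℝ` -/

/-- The standard basis of `ℝ × ℝ × ℝ`. -/
def basisVec : Fin 3 → ℝ × ℝ × ℝ := ![(1, 0, 0), (0, 1, 0), (0, 0, 1)]

/-- The coordinates of a vector of `ℝ × ℝ × ℝ`, as continuous linear forms. -/
def coord : Fin 3 → ℝ × ℝ × ℝ →L[ℝ] ℝ :=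
  ![.fst ℝ ℝ (ℝ × ℝ), .fst ℝ ℝ ℝ ∘L .snd ℝ ℝ (ℝ × ℝ), .snd ℝ ℝ ℝ ∘L .snd ℝ ℝ (ℝ × ℝ)]

/-- The `i`-th partial derivative; `pd 0`, `pd 1`, `pd 2` are `dx`, `dy`, `dz`. -/
noncomputable def pd (i : Fin 3) (f : ℝ × ℝ × ℝ → ℝ) (p : ℝ × ℝ × ℝ) : ℝ :=
  fderiv ℝ f p (basisVec i)

lemma coord_basisVec (i j : Fin 3) : coord i (basisVec j) = if i = j then 1 else 0 := by
  fin_cases i <;> fin_cases j <;> simp [coord, basisVec]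

lemma eq_sum_coord (ξ : ℝ × ℝ × ℝ) : ξ = ∑ i, coord i ξ • basisVec i := by
  simp [Fin.sum_univ_three, coord, basisVec]

lemma ext_coord {ξ η : ℝ × ℝ × ℝ} (h : ∀ i, coord i ξ = coord i η) : ξ = η := by
  rw [eq_sum_coord ξ, eq_sum_coord η]; simp [h]

lemma fderiv_eq_sum (f : ℝ × ℝ × ℝ → ℝ) (p ξ : ℝ × ℝ × ℝ) :
    fderiv ℝ f p ξ = ∑ i, coord i ξ * pd i f p := by
  conv_lhs => rw [eq_sum_coord ξ]
  simp [pd]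

section pd

variable {f g : ℝ × ℝ × ℝ → ℝ} {p : ℝ × ℝ × ℝ} {U : Set (ℝ × ℝ × ℝ)}

lemma pd_congr (i : Fin 3) (h : f =ᶠ[𝓝 p] g) : pd i f p = pd i g p := by
  rw [pd, pd, h.fderiv_eq]

lemma pd_const (i : Fin 3) (c : ℝ) : pd i (fun _ => c) p = 0 := by simp [pd]

lemma pd_add (i : Fin 3) (hf : DifferentiableAt ℝ f p) (hg : DifferentiableAt ℝ g p) :
    pd i (fun q => f q + g q) p = pd i f p + pd i g p := by
  simp [pd, fderiv_fun_add hf hg]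

lemma pd_sub (i : Fin 3) (hf : DifferentiableAt ℝ f p) (hg : DifferentiableAt ℝ g p) :
    pd i (fun q => f q - g q) p = pd i f p - pd i g p := by
  simp [pd, fderiv_fun_sub hf hg]

lemma pd_neg (i : Fin 3) : pd i (fun q => -f q) p = -pd i f p := by
  simp [pd, fderiv_fun_neg]

lemma pd_mul (i : Fin 3) (hf : DifferentiableAt ℝ f p) (hg : DifferentiableAt ℝ g p) :
    pd i (fun q => f q * g q) p = f p * pd i g p + g p * pd i f p := by
  simp [pd, fderiv_fun_mul hf hg]

lemma pd_const_mul (i : Fin 3) (c : ℝ) (hf : DifferentiableAt ℝ f p) :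
    pd i (fun q => c * f q) p = c * pd i f p := by
  simp [pd, fderiv_const_mul hf]

lemma pd_sum {α : Type*} (i : Fin 3) (s : Finset α) {f : α → ℝ × ℝ × ℝ → ℝ}
    (hf : ∀ a, DifferentiableAt ℝ (f a) p) :
    pd i (fun q => ∑ a ∈ s, f a q) p = ∑ a ∈ s, pd i (f a) p := by
  simp [pd, fderiv_fun_sum fun a _ => hf a]

lemma pd_comm (i j : Fin 3) (hf : ContDiffAt ℝ 2 f p) :
    pd i (pd j f) p = pd j (pd i f) p := by
  have hd : DifferentiableAt ℝ (fderiv ℝ f) p :=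
    (hf.fderiv_right (m := 1) (by norm_num)).differentiableAt one_ne_zero
  have h : ∀ a b : Fin 3, pd a (pd b f) p
      = fderiv ℝ (fderiv ℝ f) p (basisVec a) (basisVec b) := by
    intro a b
    have : HasFDerivAt (pd b f) _ p := hd.hasFDerivAt.clm_apply (hasFDerivAt_const (basisVec b) p)
    rw [pd, this.fderiv]
    simp
  rw [h, h, (hf.isSymmSndFDerivAt (by simp)).eq]

lemma contDiffOn_pd (hU : IsOpen U) (hf : ContDiffOn ℝ ∞ f U) (i : Fin 3) :
    ContDiffOn ℝ ∞ (pd i f) U :=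
  (hf.fderiv_of_isOpen hU (m := ∞) (by simp)).clm_apply contDiffOn_const

end pd

/-! ### The overdetermined linear system in components -/

set_option maxSynthPendingDepth 3 in
/-- **Frobenius' theorem** in components: a compatible linear system
`∂ᵢ Xₐ = ∑ c, mᵢₐ꜀ X꜀` on an open set of `ℝ³` has near each point a smooth fundamental matrix,
equal to the identity there; the second index of `X` numbers the solutions. -/
theorem exists_fundamental_matrix {ι : Type*} [Fintype ι] [DecidableEq ι]
    {U : Set (ℝ × ℝ × ℝ)} (hU : IsOpen U) {m : Fin 3 → ι → ι → ℝ × ℝ × ℝ → ℝ}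
    (hm : ∀ i a b, ContDiffOn ℝ ∞ (m i a b) U)
    (hcompat : ∀ q ∈ U, ∀ i j a b, pd i (m j a b) q + ∑ c, m j a c q * m i c b q
      = pd j (m i a b) q + ∑ c, m i a c q * m j c b q)
    {p : ℝ × ℝ × ℝ} (hp : p ∈ U) :
    ∃ X : ι → ι → ℝ × ℝ × ℝ → ℝ, ∃ V : Set (ℝ × ℝ × ℝ), IsOpen V ∧ p ∈ V ∧ V ⊆ U ∧
      (∀ a b, X a b p = if a = b then 1 else 0) ∧ (∀ a b, ContDiffOn ℝ ∞ (X a b) V) ∧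
      ∀ q ∈ V, ∀ i a b, pd i (X a b) q = ∑ c, m i a c q * X c b q := by
  -- Matrices are encoded as continuous endomorphisms of `ι → ℝ`, with entries `ev`.
  let ev : ι → ι → ((ι → ℝ) →L[ℝ] (ι → ℝ)) →L[ℝ] ℝ := fun a b =>
    .proj a ∘L ContinuousLinearMap.apply ℝ (ι → ℝ) (Pi.single b 1)
  have hev : ∀ a b A, ev a b A = A (Pi.single b 1) a := fun a b A => rfl
  have hmul : ∀ a b A B, ev a b (A * B) = ∑ c, ev a c A * ev c b B := by
    intro a b A B
    simp only [hev, mul_apply_eq_comp]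
    conv_lhs => rw [pi_eq_sum_univ' (B (Pi.single b 1))]
    simp [mul_comm]
  have hext : ∀ A B : (ι → ℝ) →L[ℝ] (ι → ℝ), (∀ a b, ev a b A = ev a b B) → A = B := by
    intro A B h
    refine ContinuousLinearMap.coe_injective (LinearMap.pi_ext' fun b => LinearMap.ext_ring ?_)
    ext a
    exact h a b
  let T : Fin 3 → ι → ι → ℝ × ℝ × ℝ →L[ℝ] (ι → ℝ) →L[ℝ] (ι → ℝ) :=
    fun i a b => (coord i).smulRight ((ContinuousLinearMap.proj b : (ι → ℝ) →L[ℝ] ℝ).smulRight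
      (Pi.single a (1 : ℝ) : ι → ℝ))
  let M : ℝ × ℝ × ℝ → ℝ × ℝ × ℝ →L[ℝ] (ι → ℝ) →L[ℝ] (ι → ℝ) :=
    fun q => ∑ i, ∑ a, ∑ b, m i a b q • T i a b
  have hTsum : ∀ (n : Fin 3 → ι → ι → ℝ) (h : ℝ × ℝ × ℝ) (a b : ι),
      ev a b ((∑ i, ∑ a, ∑ b, n i a b • T i a b) h) = ∑ i, coord i h * n i a b := by
    intro n h a b
    simp only [T, hev, sum_apply, smul_apply, ContinuousLinearMap.smulRight_apply,
      ContinuousLinearMap.proj_apply, Finset.sum_apply, Pi.smul_apply, Pi.single_apply,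
      smul_eq_mul, mul_ite, mul_one, mul_zero]
    refine Finset.sum_congr rfl fun i _ => ?_
    simp [mul_comm]
  have hd : ∀ q ∈ U, ∀ i a b, DifferentiableAt ℝ (m i a b) q := fun q hq i a b =>
    ((hm i a b).contDiffAt (hU.mem_nhds hq)).differentiableAt (by simp)
  have hM' : ∀ q ∈ U, ∀ h k a b,
      ev a b (fderiv ℝ M q h k) = ∑ i, coord i k * ∑ j, coord j h * pd j (m i a b) q := by
    intro q hq h k a b
    have : HasFDerivAt M (∑ i, ∑ a, ∑ b, (fderiv ℝ (m i a b) q).smulRight (T i a b)) q :=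
      HasFDerivAt.fun_sum fun i _ => HasFDerivAt.fun_sum fun a _ => HasFDerivAt.fun_sum fun b _ =>
        (hd q hq i a b).hasFDerivAt.smul_const (T i a b)
    rw [this.fderiv]
    have e : (∑ i, ∑ a, ∑ b, (fderiv ℝ (m i a b) q).smulRight (T i a b)) h
        = ∑ i, ∑ a, ∑ b, (fderiv ℝ (m i a b) q h) • T i a b := by
      simp only [sum_apply, ContinuousLinearMap.smulRight_apply]
    rw [e, hTsum]
    simp only [fderiv_eq_sum]
  have hflat : ∀ q ∈ U, ∀ h k, fderiv ℝ M q h k + M q k * M q h =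
      fderiv ℝ M q k h + M q h * M q k := by
    have hexp : ∀ q ∈ U, ∀ h k a b, ev a b (fderiv ℝ M q h k + M q k * M q h)
        = ∑ i, ∑ j, coord i k * coord j h *
          (pd j (m i a b) q + ∑ c, m i a c q * m j c b q) := by
      intro q hq h k a b
      rw [map_add, hM' q hq, hmul]
      simp only [M, hTsum, mul_add, Finset.sum_add_distrib, Finset.mul_sum, Finset.sum_mul]
      congr 1
      · simp only [mul_assoc]
      · rw [Finset.sum_comm]
        simp only [Finset.sum_comm (s := (Finset.univ : Finset ι))]
        rw [Finset.sum_comm]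
        refine Finset.sum_congr rfl fun i _ => Finset.sum_congr rfl fun j _ =>
          Finset.sum_congr rfl fun c _ => ?_
        ring
    intro q hq h k
    refine hext _ _ fun a b => ?_
    rw [hexp q hq, hexp q hq, Finset.sum_comm]
    refine Finset.sum_congr rfl fun i _ => Finset.sum_congr rfl fun j _ => ?_
    rw [hcompat q hq]
    ring
  have hMs : ContDiffOn ℝ ∞ M U := ContDiffOn.sum fun i _ => ContDiffOn.sum fun a _ =>
    ContDiffOn.sum fun b _ => (hm i a b).smul contDiffOn_const
  obtain ⟨X, V, hV, hpV, hVU, hXp, hXs, hX⟩ := exists_hasFDerivAt_of_flat hU hMs hflat hp 1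
  refine ⟨fun a b q => ev a b (X q), V, hV, hpV, hVU, fun a b => ?_, fun a b => ?_,
    fun q hq i a b => ?_⟩
  · simp [hXp, hev, Pi.single_apply]
  · exact (ev a b).contDiff.comp_contDiffOn hXs
  · have := ((ev a b).hasFDerivAt.comp q (hX q hq))
    change fderiv ℝ (ev a b ∘ X) q (basisVec i) = _
    rw [this.fderiv]
    simp only [ContinuousLinearMap.comp_apply, ContinuousLinearMap.flip_apply,
      ContinuousLinearMap.mul_apply', hmul, M, hTsum, coord_basisVec]
    simp

/-! ### Curves under a change of variables -/

lemma hasDerivAt_of_contDiffOn_two {I : Set ℝ} (hI : IsOpen I) {y : ℝ → ℝ}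
    (hy : ContDiffOn ℝ 2 y I) {x : ℝ} (hx : x ∈ I) :
    HasDerivAt y (deriv y x) x ∧ HasDerivAt (deriv y) (deriv (deriv y) x) x := by
  have h := (hy.contDiffAt (hI.mem_nhds hx))
  refine ⟨(h.differentiableAt (by simp)).hasDerivAt, ?_⟩
  have h1 : ContDiffOn ℝ 1 (deriv y) I :=
    ((contDiffOn_succ_iff_deriv_of_isOpen (n := 1) hI).1 (by rw [one_add_one_eq_two]; exact hy)).2.2
  exact ((h1.contDiffAt (hI.mem_nhds hx)).differentiableAt (by simp)).hasDerivAt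

/-- The first and second derivatives of `g = v ∘ u`. -/
lemma deriv_comp_of_eventuallyEq {g g' u u' v : ℝ → ℝ} {g'' u'' x : ℝ} {J : Set ℝ}
    (hJ : IsOpen J) (hv : ContDiffOn ℝ 2 v J) (huJ : ∀ᶠ t in 𝓝 x, u t ∈ J)
    (hgu : ∀ᶠ t in 𝓝 x, g t = v (u t))
    (hg : ∀ᶠ t in 𝓝 x, HasDerivAt g (g' t) t) (hg' : HasDerivAt g' g'' x)
    (hu : ∀ᶠ t in 𝓝 x, HasDerivAt u (u' t) t) (hu' : HasDerivAt u' u'' x) :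
    g' x = deriv v (u x) * u' x ∧
      g'' = deriv (deriv v) (u x) * u' x ^ 2 + deriv v (u x) * u'' := by
  have h1 : ∀ᶠ t in 𝓝 x, g' t = deriv v (u t) * u' t := by
    filter_upwards [hgu.eventually_nhds, hg, hu, huJ] with t h1 h2 h3 h4
    have h5 := (hasDerivAt_of_contDiffOn_two hJ hv h4).1.comp t h3
    exact h2.unique (h5.congr_of_eventuallyEq h1)
  refine ⟨h1.self_of_nhds, ?_⟩
  have h2 := (((hasDerivAt_of_contDiffOn_two hJ hv huJ.self_of_nhds).2.comp x
    hu.self_of_nhds).mul hu').congr_of_eventuallyEq h1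
  rw [hg'.unique h2]
  simp only [Function.comp]
  ring

/-- Suppose that `D²Φ(ξ, ξ) = DΦ(N ξ)` at the point `(x, y x, z x)`, for the tangent vector
`ξ = (1, y', z')` of a curve, and that `Φ` maps the curve into a graph `(u, v u, w u)`. Then
`v'' = w'' = 0` at the image point if and only if the acceleration `(0, y'', z'') + N` is
proportional to `ξ`, i.e. equals `N₁ ξ`. -/
lemma free_iff_geodesic {Φ : ℝ × ℝ × ℝ → ℝ × ℝ × ℝ} {I J : Set ℝ} {y z v w : ℝ → ℝ} {x : ℝ}
    (hI : IsOpen I) (hJ : IsOpen J) (hx : x ∈ I)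
    (hy : ContDiffOn ℝ 2 y I) (hz : ContDiffOn ℝ 2 z I)
    (hv : ContDiffOn ℝ 2 v J) (hw : ContDiffOn ℝ 2 w J)
    (hΦ : ∀ t ∈ I, ContDiffAt ℝ 2 Φ (t, y t, z t))
    (hinj : Function.Injective (fderiv ℝ Φ (x, y x, z x)))
    (hgraph : ∀ t ∈ I, ∃ u ∈ J, Φ (t, y t, z t) = (u, v u, w u))
    {n : ℝ × ℝ × ℝ}
    (hn : fderiv ℝ (fderiv ℝ Φ) (x, y x, z x) (1, deriv y x, deriv z x) (1, deriv y x, deriv z x)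
      = fderiv ℝ Φ (x, y x, z x) n) :
    (deriv (deriv v) (Φ (x, y x, z x)).1 = 0 ∧ deriv (deriv w) (Φ (x, y x, z x)).1 = 0) ↔
      (deriv (deriv y) x + n.2.1 = n.1 * deriv y x ∧
        deriv (deriv z) x + n.2.2 = n.1 * deriv z x) := by
  obtain ⟨c, hc⟩ : ∃ c : ℝ → ℝ × ℝ × ℝ, c = fun t => (t, y t, z t) := ⟨_, rfl⟩
  obtain ⟨c', hc'⟩ : ∃ c' : ℝ → ℝ × ℝ × ℝ, c' = fun t => (1, deriv y t, deriv z t) := ⟨_, rfl⟩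
  obtain ⟨a, ha⟩ : ∃ a : ℝ × ℝ × ℝ, a = (0, deriv (deriv y) x, deriv (deriv z) x) := ⟨_, rfl⟩
  have hcx : ∀ t, (t, y t, z t) = c t := fun t => by rw [hc]
  have hcx' : ∀ t, (1, deriv y t, deriv z t) = c' t := fun t => by rw [hc']
  simp only [hcx, hcx'] at hΦ hinj hgraph hn ⊢
  have hcd : ∀ t ∈ I, HasDerivAt c (c' t) t := fun t ht => by
    rw [hc, hc']
    exact (hasDerivAt_id t).prodMk ((hasDerivAt_of_contDiffOn_two hI hy ht).1.prodMk
      (hasDerivAt_of_contDiffOn_two hI hz ht).1)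
  have hcd' : HasDerivAt c' a x := by
    rw [hc', ha]
    exact (hasDerivAt_const x (1 : ℝ)).prodMk ((hasDerivAt_of_contDiffOn_two hI hy hx).2.prodMk
      (hasDerivAt_of_contDiffOn_two hI hz hx).2)
  obtain ⟨T, hT⟩ : ∃ T : ℝ → ℝ × ℝ × ℝ, T = fun t => fderiv ℝ Φ (c t) (c' t) := ⟨_, rfl⟩
  have hΓ : ∀ t ∈ I, HasDerivAt (fun t => Φ (c t)) (T t) t := fun t ht => by
    rw [hT]
    exact ((hΦ t ht).differentiableAt (by simp)).hasFDerivAt.comp_hasDerivAt t (hcd t ht)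
  have hT' : HasDerivAt T (fderiv ℝ Φ (c x) (n + a)) x := by
    have h1 : HasFDerivAt (fderiv ℝ Φ) (fderiv ℝ (fderiv ℝ Φ) (c x)) (c x) :=
      (((hΦ x hx).fderiv_right (m := 1) (by norm_num)).differentiableAt
        one_ne_zero).hasFDerivAt
    rw [hT, map_add, ← hn]
    exact (h1.comp_hasDerivAt x (hcd x hx)).clm_apply hcd'
  have hIx : ∀ᶠ t in 𝓝 x, t ∈ I := hI.mem_nhds hx
  have hΓe := hIx.mono hΓ
  have hproj : ∀ L : ℝ × ℝ × ℝ →L[ℝ] ℝ,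
      (∀ᶠ t in 𝓝 x, HasDerivAt (fun t => L (Φ (c t))) (L (T t)) t) ∧
      HasDerivAt (fun t => L (T t)) (L (fderiv ℝ Φ (c x) (n + a))) x := fun L =>
    ⟨hΓe.mono fun t ht => L.hasFDerivAt.comp_hasDerivAt t ht,
      L.hasFDerivAt.comp_hasDerivAt x hT'⟩
  have h0 := hproj (.fst ℝ ℝ (ℝ × ℝ))
  have h1 := hproj (.fst ℝ ℝ ℝ ∘L .snd ℝ ℝ (ℝ × ℝ))
  have h2 := hproj (.snd ℝ ℝ ℝ ∘L .snd ℝ ℝ (ℝ × ℝ))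
  have hu : ∀ t ∈ I, (Φ (c t)).1 ∈ J ∧ (Φ (c t)).2.1 = v (Φ (c t)).1 ∧
      (Φ (c t)).2.2 = w (Φ (c t)).1 := by
    intro t ht
    obtain ⟨u, huJ, hu⟩ := hgraph t ht
    rw [hu]
    exact ⟨huJ, rfl, rfl⟩
  obtain ⟨hv1, hv2⟩ := deriv_comp_of_eventuallyEq hJ hv (hIx.mono fun t ht => (hu t ht).1)
    (hIx.mono fun t ht => (hu t ht).2.1) h1.1 h1.2 h0.1 h0.2
  obtain ⟨hw1, hw2⟩ := deriv_comp_of_eventuallyEq hJ hw (hIx.mono fun t ht => (hu t ht).1)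
    (hIx.mono fun t ht => (hu t ht).2.2) h2.1 h2.2 h0.1 h0.2
  simp only [ContinuousLinearMap.comp_apply, ContinuousLinearMap.coe_fst',
    ContinuousLinearMap.coe_snd'] at hv1 hv2 hw1 hw2
  obtain ⟨u₁, hu₁⟩ : ∃ u₁, u₁ = (Φ (c x)).1 := ⟨_, rfl⟩
  rw [← hu₁] at hv1 hv2 hw1 hw2 ⊢
  have hTx : T x = fderiv ℝ Φ (c x) (c' x) := by rw [hT]
  have hT0 : (T x).1 ≠ 0 := by
    intro h
    have h3 : T x = 0 := by
      refine Prod.ext h (Prod.ext ?_ ?_)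
      · rw [hv1, h, mul_zero]; rfl
      · rw [hw1, h, mul_zero]; rfl
    rw [hTx] at h3
    have h4 := hinj (h3.trans (map_zero _).symm)
    rw [hc'] at h4
    exact one_ne_zero (congrArg Prod.fst h4)
  constructor
  · rintro ⟨hv0, hw0⟩
    rw [hv0, zero_mul, zero_add] at hv2
    rw [hw0, zero_mul, zero_add] at hw2
    obtain ⟨l, hl⟩ : ∃ l, (fderiv ℝ Φ (c x) (n + a)).1 = l * (T x).1 :=
      ⟨_, (div_mul_cancel₀ _ hT0).symm⟩
    have h3 : fderiv ℝ Φ (c x) (n + a) = fderiv ℝ Φ (c x) (l • c' x) := by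
      rw [map_smul, ← hTx]
      refine Prod.ext hl (Prod.ext ?_ ?_)
      · rw [hv2, hl]; simp only [Prod.smul_snd, Prod.smul_fst, smul_eq_mul]; rw [hv1]; ring
      · rw [hw2, hl]; simp only [Prod.smul_snd, smul_eq_mul]; rw [hw1]; ring
    have h4 := hinj h3
    rw [ha, hc'] at h4
    have e0 := congrArg Prod.fst h4
    have e1 := congrArg (fun q => q.2.1) h4
    have e2 := congrArg (fun q => q.2.2) h4
    simp only [Prod.fst_add, Prod.snd_add, Prod.smul_snd, Prod.smul_fst, smul_eq_mul, mul_one,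
      add_zero] at e0 e1 e2
    constructor
    · rw [e0]; linarith
    · rw [e0]; linarith
  · rintro ⟨hy0, hz0⟩
    have h3 : n + a = n.1 • c' x := by
      rw [ha, hc']
      refine Prod.ext ?_ (Prod.ext ?_ ?_)
      · simp
      · simp only [Prod.snd_add, Prod.fst_add, Prod.smul_snd, Prod.smul_fst, smul_eq_mul]
        linarith
      · simp only [Prod.snd_add, Prod.smul_snd, smul_eq_mul]
        linarith
    rw [h3, map_smul, ← hTx] at hv2 hw2
    simp only [Prod.smul_snd, Prod.smul_fst, smul_eq_mul] at hv2 hw2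
    rw [hv1] at hv2
    rw [hw1] at hw2
    have hT2 : (T x).1 ^ 2 ≠ 0 := pow_ne_zero _ hT0
    constructor
    · refine (mul_eq_zero.1 ?_).resolve_right hT2
      linear_combination -hv2
    · refine (mul_eq_zero.1 ?_).resolve_right hT2
      linear_combination -hw2

/-- The part of the first equation of the system without `y''`, as a function of the point and of
`a = y'`, `b = z'`. -/
def System.rhs2 (S : System) (q : ℝ × ℝ × ℝ) (a b : ℝ) : ℝ :=
  S.A22 q * a ^ 3 + 2 * S.A23 q * a ^ 2 * b + S.A33 q * a * b ^ 2 + S.B222 q * a ^ 2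
    + 2 * S.B223 q * a * b + S.B233 q * b ^ 2 + S.C22 q * a + S.C23 q * b + S.D2 q

/-- The part of the second equation of the system without `z''`. -/
def System.rhs3 (S : System) (q : ℝ × ℝ × ℝ) (a b : ℝ) : ℝ :=
  S.A22 q * a ^ 2 * b + 2 * S.A23 q * a * b ^ 2 + S.A33 q * b ^ 3 + S.B322 q * a ^ 2
    + 2 * S.B323 q * a * b + S.B333 q * b ^ 2 + S.C32 q * a + S.C33 q * b + S.D3 q

lemma System.isSolutionOn_iff (S : System) {I : Set ℝ} {y z : ℝ → ℝ}
    (hy : ContDiffOn ℝ 2 y I) (hz : ContDiffOn ℝ 2 z I) :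
    S.IsSolutionOn I y z ↔ ∀ x ∈ I,
      deriv (deriv y) x + S.rhs2 (x, y x, z x) (deriv y x) (deriv z x) = 0 ∧
      deriv (deriv z) x + S.rhs3 (x, y x, z x) (deriv y x) (deriv z x) = 0 := by
  simp only [System.IsSolutionOn, hy, hz, true_and, System.rhs2, System.rhs3, ← add_assoc]

/-- A change of variables `Φ` with `D²Φ(ξ, ξ) = DΦ(N(ξ))` carries the system to the simplest one as
soon as the nonlinear terms of the system are those of the equation of the curves whose
acceleration `c'' + N(c')` is proportional to `c'`. -/
lemma System.mapsToFree_of_quadratic {S : System}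
    {Φ : OpenPartialHomeomorph (ℝ × ℝ × ℝ) (ℝ × ℝ × ℝ)} (hΦ : ContDiffOn ℝ ∞ Φ Φ.source)
    (hinj : ∀ q ∈ Φ.source, Function.Injective (fderiv ℝ Φ q))
    {N : ℝ × ℝ × ℝ → ℝ × ℝ × ℝ → ℝ × ℝ × ℝ}
    (hN : ∀ q ∈ Φ.source, ∀ ξ, fderiv ℝ (fderiv ℝ Φ) q ξ ξ = fderiv ℝ Φ q (N q ξ))
    (hS2 : ∀ q ∈ Φ.source, ∀ a b, S.rhs2 q a b = (N q (1, a, b)).2.1 - (N q (1, a, b)).1 * a)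
    (hS3 : ∀ q ∈ Φ.source, ∀ a b, S.rhs3 q a b = (N q (1, a, b)).2.2 - (N q (1, a, b)).1 * b) :
    S.MapsToFree Φ := by
  intro I J y z v w hI _ hJ _ hy hz hv hw hsub himg
  have hsrc : ∀ x ∈ I, (x, y x, z x) ∈ Φ.source := fun x hx => hsub ⟨x, hx, rfl⟩
  have hgraph : ∀ x ∈ I, ∃ u ∈ J, Φ (x, y x, z x) = (u, v u, w u) := by
    intro x hx
    have : Φ (x, y x, z x) ∈ curve J v w := by
      rw [← himg]; exact ⟨_, ⟨x, hx, rfl⟩, rfl⟩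
    obtain ⟨u, hu, he⟩ := this
    exact ⟨u, hu, he.symm⟩
  have hgraph' : ∀ u ∈ J, ∃ x ∈ I, (Φ (x, y x, z x)).1 = u := by
    intro u hu
    have : (u, v u, w u) ∈ Φ '' curve I y z := by rw [himg]; exact ⟨u, hu, rfl⟩
    obtain ⟨_, ⟨x, hx, rfl⟩, he⟩ := this
    exact ⟨x, hx, congrArg Prod.fst he⟩
  have key : ∀ x ∈ I, (deriv (deriv v) (Φ (x, y x, z x)).1 = 0 ∧
      deriv (deriv w) (Φ (x, y x, z x)).1 = 0) ↔
      (deriv (deriv y) x + S.rhs2 (x, y x, z x) (deriv y x) (deriv z x) = 0 ∧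
      deriv (deriv z) x + S.rhs3 (x, y x, z x) (deriv y x) (deriv z x) = 0) := by
    intro x hx
    rw [free_iff_geodesic hI hJ hx hy hz hv hw
      (fun t ht => contDiffAt_infty.1 (hΦ.contDiffAt (Φ.open_source.mem_nhds (hsrc t ht))) 2)
      (hinj _ (hsrc x hx)) hgraph (hN _ (hsrc x hx) _), hS2 _ (hsrc x hx), hS3 _ (hsrc x hx)]
    constructor <;> rintro ⟨h1, h2⟩ <;> constructor <;> linarith
  rw [S.isSolutionOn_iff hy hz]
  constructor
  · intro h
    refine ⟨hv, hw, fun u hu => ?_⟩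
    obtain ⟨x, hx, rfl⟩ := hgraph' u hu
    exact (key x hx).2 (h x hx)
  · rintro ⟨-, -, h⟩ x hx
    obtain ⟨u, hu, he⟩ := hgraph x hx
    refine (key x hx).1 ?_
    rw [he]
    exact h u hu

/-! ### Connections and the systems they represent -/

/-- The curvature `R^l_{kij}` of the affine connection with Christoffel symbols `G l i j`. -/
noncomputable def curv (G : Fin 3 → Fin 3 → Fin 3 → ℝ × ℝ × ℝ → ℝ) (l k i j : Fin 3)
    (p : ℝ × ℝ × ℝ) : ℝ :=
  pd i (G l j k) p - pd j (G l i k) p + ∑ m, (G l i m p * G m j k p - G l j m p * G m i k p)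

/-- The vector with components `∑ i j, G^l_{ij} ξⁱ ξʲ`. -/
noncomputable def quad (G : Fin 3 → Fin 3 → Fin 3 → ℝ × ℝ × ℝ → ℝ) (q ξ : ℝ × ℝ × ℝ) :
    ℝ × ℝ × ℝ :=
  ∑ l, (∑ i, ∑ j, G l i j q * coord i ξ * coord j ξ) • basisVec l

lemma coord_quad (G : Fin 3 → Fin 3 → Fin 3 → ℝ × ℝ × ℝ → ℝ) (q ξ : ℝ × ℝ × ℝ) (l : Fin 3) :
    coord l (quad G q ξ) = ∑ i, ∑ j, G l i j q * coord i ξ * coord j ξ := by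
  simp only [quad, map_sum, map_smul, coord_basisVec]
  simp

/-- At the point `q`, the system is that of the unparametrized geodesics, written as graphs over
the `x`-axis, of the connection with Christoffel symbols `G l i j`. Indices `0, 1, 2` stand
for `x, y, z`. -/
def System.IsRepresentedBy (S : System) (G : Fin 3 → Fin 3 → Fin 3 → ℝ × ℝ × ℝ → ℝ)
    (q : ℝ × ℝ × ℝ) : Prop :=
  S.A22 q = -G 0 1 1 q ∧ S.A23 q = -G 0 1 2 q ∧ S.A33 q = -G 0 2 2 q ∧
  S.B222 q = G 1 1 1 q - 2 * G 0 0 1 q ∧ S.B223 q = G 1 1 2 q - G 0 0 2 q ∧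
  S.B233 q = G 1 2 2 q ∧ S.B322 q = G 2 1 1 q ∧
  S.B323 q = G 2 1 2 q - G 0 0 1 q ∧ S.B333 q = G 2 2 2 q - 2 * G 0 0 2 q ∧
  S.C22 q = 2 * G 1 0 1 q - G 0 0 0 q ∧ S.C23 q = 2 * G 1 0 2 q ∧
  S.C32 q = 2 * G 2 0 1 q ∧ S.C33 q = 2 * G 2 0 2 q - G 0 0 0 q ∧
  S.D2 q = G 1 0 0 q ∧ S.D3 q = G 2 0 0 q

/-- The system whose coefficients are the `i`-th partial derivatives of those of `S`. -/
noncomputable def System.pd (S : System) (i : Fin 3) : System where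
  A22 := CubicODE.pd i S.A22
  A23 := CubicODE.pd i S.A23
  A33 := CubicODE.pd i S.A33
  B222 := CubicODE.pd i S.B222
  B223 := CubicODE.pd i S.B223
  B233 := CubicODE.pd i S.B233
  B322 := CubicODE.pd i S.B322
  B323 := CubicODE.pd i S.B323
  B333 := CubicODE.pd i S.B333
  C22 := CubicODE.pd i S.C22
  C23 := CubicODE.pd i S.C23
  C32 := CubicODE.pd i S.C32
  C33 := CubicODE.pd i S.C33
  D2 := CubicODE.pd i S.D2
  D3 := CubicODE.pd i S.D3

/-- The coefficients are linear in the Christoffel symbols, so differentiating the latter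
differentiates the former. -/
lemma System.IsRepresentedBy.pd {S : System} {G : Fin 3 → Fin 3 → Fin 3 → ℝ × ℝ × ℝ → ℝ}
    {p : ℝ × ℝ × ℝ} (h : ∀ᶠ q in 𝓝 p, S.IsRepresentedBy G q)
    (hG : ∀ l i j, DifferentiableAt ℝ (G l i j) p) (i : Fin 3) :
    (S.pd i).IsRepresentedBy (fun l a b => CubicODE.pd i (G l a b)) p := by
  have h2 : ∀ l i j, DifferentiableAt ℝ (fun q => 2 * G l i j q) p :=
    fun l i j => (hG l i j).const_mul 2
  simp only [System.IsRepresentedBy, System.pd]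
  refine ⟨?_, ?_, ?_, ?_, ?_, ?_, ?_, ?_, ?_, ?_, ?_, ?_, ?_, ?_, ?_⟩
  · rw [← pd_neg]; exact pd_congr i (h.mono fun q hq => hq.1)
  · rw [← pd_neg]; exact pd_congr i (h.mono fun q hq => hq.2.1)
  · rw [← pd_neg]; exact pd_congr i (h.mono fun q hq => hq.2.2.1)
  · rw [← pd_const_mul i _ (hG _ _ _), ← pd_sub i (hG _ _ _) (h2 _ _ _)]
    exact pd_congr i (h.mono fun q hq => hq.2.2.2.1)
  · rw [← pd_sub i (hG _ _ _) (hG _ _ _)]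
    exact pd_congr i (h.mono fun q hq => hq.2.2.2.2.1)
  · exact pd_congr i (h.mono fun q hq => hq.2.2.2.2.2.1)
  · exact pd_congr i (h.mono fun q hq => hq.2.2.2.2.2.2.1)
  · rw [← pd_sub i (hG _ _ _) (hG _ _ _)]
    exact pd_congr i (h.mono fun q hq => hq.2.2.2.2.2.2.2.1)
  · rw [← pd_const_mul i _ (hG _ _ _), ← pd_sub i (hG _ _ _) (h2 _ _ _)]
    exact pd_congr i (h.mono fun q hq => hq.2.2.2.2.2.2.2.2.1)
  · rw [← pd_const_mul i _ (hG _ _ _), ← pd_sub i (h2 _ _ _) (hG _ _ _)]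
    exact pd_congr i (h.mono fun q hq => hq.2.2.2.2.2.2.2.2.2.1)
  · rw [← pd_const_mul i _ (hG _ _ _)]
    exact pd_congr i (h.mono fun q hq => hq.2.2.2.2.2.2.2.2.2.2.1)
  · rw [← pd_const_mul i _ (hG _ _ _)]
    exact pd_congr i (h.mono fun q hq => hq.2.2.2.2.2.2.2.2.2.2.2.1)
  · rw [← pd_const_mul i _ (hG _ _ _), ← pd_sub i (h2 _ _ _) (hG _ _ _)]
    exact pd_congr i (h.mono fun q hq => hq.2.2.2.2.2.2.2.2.2.2.2.2.1)
  · exact pd_congr i (h.mono fun q hq => hq.2.2.2.2.2.2.2.2.2.2.2.2.2.1)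
  · exact pd_congr i (h.mono fun q hq => hq.2.2.2.2.2.2.2.2.2.2.2.2.2.2)

/-- A cubic polynomial in two variables that vanishes identically has zero coefficients. -/
lemma coeff_eq_zero_of_cubic_eq_zero {c30 c21 c12 c03 c20 c11 c02 c10 c01 c00 : ℝ}
    (h : ∀ a b : ℝ, c30 * a ^ 3 + c21 * a ^ 2 * b + c12 * a * b ^ 2 + c03 * b ^ 3
      + c20 * a ^ 2 + c11 * a * b + c02 * b ^ 2 + c10 * a + c01 * b + c00 = 0) :
    c30 = 0 ∧ c21 = 0 ∧ c12 = 0 ∧ c03 = 0 ∧ c20 = 0 ∧ c11 = 0 ∧ c02 = 0 ∧ c10 = 0 ∧ c01 = 0 ∧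
      c00 = 0 := by
  have h1 := h 0 0
  have h2 := h 1 0
  have h3 := h (-1) 0
  have h4 := h 2 0
  have h5 := h 0 1
  have h6 := h 0 (-1)
  have h7 := h 0 2
  have h8 := h 1 1
  have h9 := h 1 (-1)
  have h10 := h (-1) 1
  norm_num at h1 h2 h3 h4 h5 h6 h7 h8 h9 h10
  refine ⟨?_, ?_, ?_, ?_, ?_, ?_, ?_, ?_, ?_, ?_⟩ <;> linarith

section

variable {S : System} {G : Fin 3 → Fin 3 → Fin 3 → ℝ × ℝ × ℝ → ℝ} {q : ℝ × ℝ × ℝ}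

lemma rhs_quad_expand (hsym : ∀ l i j, G l i j q = G l j i q) (l : Fin 3) (a b : ℝ) :
    coord l (quad G q (1, a, b)) = G l 0 0 q + 2 * G l 0 1 q * a + 2 * G l 0 2 q * b
      + G l 1 1 q * a ^ 2 + 2 * G l 1 2 q * a * b + G l 2 2 q * b ^ 2 := by
  rw [coord_quad]
  simp only [Fin.sum_univ_three, hsym l 1 0, hsym l 2 0, hsym l 2 1]
  simp [coord]
  ring

/-- A system represented by a connection is the system of its unparametrized geodesics. -/
lemma System.IsRepresentedBy.rhs_eq (h : S.IsRepresentedBy G q)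
    (hsym : ∀ l i j, G l i j q = G l j i q) (a b : ℝ) :
    S.rhs2 q a b = (quad G q (1, a, b)).2.1 - (quad G q (1, a, b)).1 * a ∧
    S.rhs3 q a b = (quad G q (1, a, b)).2.2 - (quad G q (1, a, b)).1 * b := by
  have h0 : (quad G q (1, a, b)).1 = _ := rhs_quad_expand hsym 0 a b
  have h1 : (quad G q (1, a, b)).2.1 = _ := rhs_quad_expand hsym 1 a b
  have h2 : (quad G q (1, a, b)).2.2 = _ := rhs_quad_expand hsym 2 a b
  obtain ⟨e1, e2, e3, e4, e5, e6, e7, e8, e9, e10, e11, e12, e13, e14, e15⟩ := h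
  rw [h0, h1, h2, System.rhs2, System.rhs3, e1, e2, e3, e4, e5, e6, e7, e8, e9, e10, e11, e12,
    e13, e14, e15]
  constructor <;> ring

/-- Conversely, the coefficients of the system can be read off from its geodesic form. -/
lemma System.isRepresentedBy_of_rhs_eq (hsym : ∀ l i j, G l i j q = G l j i q)
    (h2 : ∀ a b, S.rhs2 q a b = (quad G q (1, a, b)).2.1 - (quad G q (1, a, b)).1 * a)
    (h3 : ∀ a b, S.rhs3 q a b = (quad G q (1, a, b)).2.2 - (quad G q (1, a, b)).1 * b) :
    S.IsRepresentedBy G q := by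
  have e0 : ∀ a b, (quad G q (1, a, b)).1 = _ := rhs_quad_expand hsym 0
  have e1 : ∀ a b, (quad G q (1, a, b)).2.1 = _ := rhs_quad_expand hsym 1
  have e2 : ∀ a b, (quad G q (1, a, b)).2.2 = _ := rhs_quad_expand hsym 2
  simp only [e0, e1, e2, System.rhs2, System.rhs3] at h2 h3
  have k2 := coeff_eq_zero_of_cubic_eq_zero
    (c30 := S.A22 q + G 0 1 1 q) (c21 := 2 * S.A23 q + 2 * G 0 1 2 q)
    (c12 := S.A33 q + G 0 2 2 q) (c03 := 0)
    (c20 := S.B222 q - G 1 1 1 q + 2 * G 0 0 1 q)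
    (c11 := 2 * S.B223 q - 2 * G 1 1 2 q + 2 * G 0 0 2 q)
    (c02 := S.B233 q - G 1 2 2 q) (c10 := S.C22 q - 2 * G 1 0 1 q + G 0 0 0 q)
    (c01 := S.C23 q - 2 * G 1 0 2 q) (c00 := S.D2 q - G 1 0 0 q)
    (fun a b => by linear_combination h2 a b)
  have k3 := coeff_eq_zero_of_cubic_eq_zero
    (c30 := 0) (c21 := S.A22 q + G 0 1 1 q) (c12 := 2 * S.A23 q + 2 * G 0 1 2 q)
    (c03 := S.A33 q + G 0 2 2 q)
    (c20 := S.B322 q - G 2 1 1 q)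
    (c11 := 2 * S.B323 q - 2 * G 2 1 2 q + 2 * G 0 0 1 q)
    (c02 := S.B333 q - G 2 2 2 q + 2 * G 0 0 2 q) (c10 := S.C32 q - 2 * G 2 0 1 q)
    (c01 := S.C33 q - 2 * G 2 0 2 q + G 0 0 0 q) (c00 := S.D3 q - G 2 0 0 q)
    (fun a b => by linear_combination h3 a b)
  obtain ⟨a1, a2, a3, -, a4, a5, a6, a7, a8, a9⟩ := k2
  obtain ⟨-, -, -, -, b4, b5, b6, b7, b8, b9⟩ := k3
  refine ⟨?_, ?_, ?_, ?_, ?_, ?_, ?_, ?_, ?_, ?_, ?_, ?_, ?_, ?_, ?_⟩ <;> linarith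

end

set_option linter.unusedSimpArgs false in
/-- Each of the fifteen expressions is a linear combination of curvature components of any
connection representing the system; so they vanish for the systems represented by a flat one. -/
lemma System.fifteenConditions_of_curv_eq_zero {S : System}
    {G : Fin 3 → Fin 3 → Fin 3 → ℝ × ℝ × ℝ → ℝ} {p : ℝ × ℝ × ℝ}
    (hsym : ∀ l i j, G l i j =ᶠ[𝓝 p] G l j i)
    (h : ∀ᶠ q in 𝓝 p, S.IsRepresentedBy G q) (hG : ∀ l i j, DifferentiableAt ℝ (G l i j) p)
    (hR : ∀ l k i j, curv G l k i j p = 0) : S.FifteenConditions p := by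
  have he := h.self_of_nhds
  have hx := System.IsRepresentedBy.pd h hG 0
  have hy := System.IsRepresentedBy.pd h hG 1
  have hz := System.IsRepresentedBy.pd h hG 2
  have hdx : dx = CubicODE.pd 0 := rfl
  have hdy : dy = CubicODE.pd 1 := rfl
  have hdz : dz = CubicODE.pd 2 := rfl
  have hs : ∀ l i j, G l i j p = G l j i p := fun l i j => (hsym l i j).self_of_nhds
  have hd : ∀ a l i j, CubicODE.pd a (G l i j) p = CubicODE.pd a (G l j i) p :=
    fun a l i j => pd_congr a (hsym l i j)
  simp only [System.IsRepresentedBy, System.pd] at he hx hy hz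
  simp only [System.FifteenConditions, hdx, hdy, hdz, he, hx, hy, hz]
  simp only [curv, Fin.sum_univ_three] at hR
  refine ⟨?_, ?_, ?_, ?_, ?_, ?_, ?_, ?_, ?_, ?_, ?_, ?_, ?_, ?_, ?_⟩
  · linear_combination (norm := (simp only [hs _ 1 0, hs _ 2 0, hs _ 2 1,
      hd _ _ 1 0, hd _ _ 2 0, hd _ _ 2 1]; ring))
      hR 2 0 0 1
  · linear_combination (norm := (simp only [hs _ 1 0, hs _ 2 0, hs _ 2 1,
      hd _ _ 1 0, hd _ _ 2 0, hd _ _ 2 1]; ring))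
      hR 2 1 0 1
  · linear_combination (norm := (simp only [hs _ 1 0, hs _ 2 0, hs _ 2 1,
      hd _ _ 1 0, hd _ _ 2 0, hd _ _ 2 1]; ring))
      (-1/3) * hR 0 0 0 1 + (-1/3) * hR 1 1 0 1 + (-1) * hR 2 0 1 2 + hR 2 1 0 2
  · linear_combination (norm := (simp only [hs _ 1 0, hs _ 2 0, hs _ 2 1,
      hd _ _ 1 0, hd _ _ 2 0, hd _ _ 2 1]; ring))
      hR 1 0 0 2
  · linear_combination (norm := (simp only [hs _ 1 0, hs _ 2 0, hs _ 2 1,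
      hd _ _ 1 0, hd _ _ 2 0, hd _ _ 2 1]; ring))
      hR 1 2 0 2
  · linear_combination (norm := (simp only [hs _ 1 0, hs _ 2 0, hs _ 2 1,
      hd _ _ 1 0, hd _ _ 2 0, hd _ _ 2 1]; ring))
      hR 0 1 1 2
  · linear_combination (norm := (simp only [hs _ 1 0, hs _ 2 0, hs _ 2 1,
      hd _ _ 1 0, hd _ _ 2 0, hd _ _ 2 1]; ring))
      hR 0 2 1 2
  · linear_combination (norm := (simp only [hs _ 1 0, hs _ 2 0, hs _ 2 1,
      hd _ _ 1 0, hd _ _ 2 0, hd _ _ 2 1]; ring))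
      hR 0 1 0 2 + (-2/3) * hR 1 1 1 2 + (1/3) * hR 2 2 1 2
  · linear_combination (norm := (simp only [hs _ 1 0, hs _ 2 0, hs _ 2 1,
      hd _ _ 1 0, hd _ _ 2 0, hd _ _ 2 1]; ring))
      hR 0 2 0 2 + (-1) * hR 1 2 1 2
  · linear_combination (norm := (simp only [hs _ 1 0, hs _ 2 0, hs _ 2 1,
      hd _ _ 1 0, hd _ _ 2 0, hd _ _ 2 1]; ring))
      (1/3) * hR 0 0 0 1 + (-2/3) * hR 1 1 0 1 + hR 2 1 0 2
  · linear_combination (norm := (simp only [hs _ 1 0, hs _ 2 0, hs _ 2 1,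
      hd _ _ 1 0, hd _ _ 2 0, hd _ _ 2 1]; ring))
      hR 0 1 0 1 + hR 2 1 1 2
  · linear_combination (norm := (simp only [hs _ 1 0, hs _ 2 0, hs _ 2 1,
      hd _ _ 1 0, hd _ _ 2 0, hd _ _ 2 1]; ring))
      (-1) * hR 1 0 0 1 + hR 2 0 0 2
  · linear_combination (norm := (simp only [hs _ 1 0, hs _ 2 0, hs _ 2 1,
      hd _ _ 1 0, hd _ _ 2 0, hd _ _ 2 1]; ring))
      (-2) * hR 0 0 1 2 + 2 * hR 0 1 0 2 + (-2/3) * hR 1 1 1 2 + (4/3) * hR 2 2 1 2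
  · linear_combination (norm := (simp only [hs _ 1 0, hs _ 2 0, hs _ 2 1,
      hd _ _ 1 0, hd _ _ 2 0, hd _ _ 2 1]; ring))
      (-1) * hR 0 0 0 2 + hR 1 0 1 2 + hR 1 1 0 2
  · linear_combination (norm := (simp only [hs _ 1 0, hs _ 2 0, hs _ 2 1,
      hd _ _ 1 0, hd _ _ 2 0, hd _ _ 2 1]; ring))
      (-1) * hR 0 0 0 2 + 2 * hR 1 0 1 2 + (-1) * hR 1 1 0 2 + hR 2 2 0 2

/-! ### Partial derivatives of the components of a map -/

section

variable {Φ : ℝ × ℝ × ℝ → ℝ × ℝ × ℝ} {s : Set (ℝ × ℝ × ℝ)} {q : ℝ × ℝ × ℝ}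

lemma pd_coord_comp (hs : IsOpen s) (hΦ : ContDiffOn ℝ ∞ Φ s) (hq : q ∈ s) (a j : Fin 3) :
    pd j (fun t => coord a (Φ t)) q = coord a (fderiv ℝ Φ q (basisVec j)) := by
  have : HasFDerivAt (fun t => coord a (Φ t)) (coord a ∘L fderiv ℝ Φ q) q :=
    (coord a).hasFDerivAt.comp q
      ((hΦ.contDiffAt (hs.mem_nhds hq)).differentiableAt (by simp)).hasFDerivAt
  rw [pd, this.fderiv]
  rfl

lemma pd_pd_coord_comp (hs : IsOpen s) (hΦ : ContDiffOn ℝ ∞ Φ s) (hq : q ∈ s) (a i j : Fin 3) :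
    pd i (pd j fun t => coord a (Φ t)) q
      = coord a (fderiv ℝ (fderiv ℝ Φ) q (basisVec i) (basisVec j)) := by
  have h2 : HasFDerivAt (fderiv ℝ Φ) (fderiv ℝ (fderiv ℝ Φ) q) q :=
    (((hΦ.fderiv_of_isOpen hs (m := ∞) (by simp)).contDiffAt
      (hs.mem_nhds hq)).differentiableAt (by simp)).hasFDerivAt
  have h3 := (coord a).hasFDerivAt.comp q
    (h2.clm_apply (hasFDerivAt_const (basisVec j) q))
  rw [pd, (h3.congr_of_eventuallyEq (f₁ := pd j fun t => coord a (Φ t)) (by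
    filter_upwards [hs.mem_nhds hq] with t ht using pd_coord_comp hs hΦ ht a j)).fderiv]
  simp

end

/-! ### The flat connection pulled back by a change of variables -/

/-- The vector `DΦ⁻¹(D²Φ(ξ, η))` at `q`. -/
noncomputable def pullback (Φ : OpenPartialHomeomorph (ℝ × ℝ × ℝ) (ℝ × ℝ × ℝ))
    (q ξ η : ℝ × ℝ × ℝ) : ℝ × ℝ × ℝ :=
  fderiv ℝ Φ.symm (Φ q) (fderiv ℝ (fderiv ℝ Φ) q ξ η)

/-- The Christoffel symbols of the connection that the change of variables `Φ` pulls back from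
the flat one. -/
noncomputable def pullbackSymbol (Φ : OpenPartialHomeomorph (ℝ × ℝ × ℝ) (ℝ × ℝ × ℝ))
    (l i j : Fin 3) (q : ℝ × ℝ × ℝ) : ℝ :=
  coord l (pullback Φ q (basisVec i) (basisVec j))

section

variable {Φ : OpenPartialHomeomorph (ℝ × ℝ × ℝ) (ℝ × ℝ × ℝ)} {q : ℝ × ℝ × ℝ}

lemma fderiv_symm_fderiv (hΦ : ContDiffOn ℝ ∞ Φ Φ.source) (hΨ : ContDiffOn ℝ ∞ Φ.symm Φ.target)
    (hq : q ∈ Φ.source) (ξ : ℝ × ℝ × ℝ) :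
    fderiv ℝ Φ.symm (Φ q) (fderiv ℝ Φ q ξ) = ξ ∧ fderiv ℝ Φ q (fderiv ℝ Φ.symm (Φ q) ξ) = ξ := by
  have h1 : HasFDerivAt Φ (fderiv ℝ Φ q) q :=
    ((hΦ.contDiffAt (Φ.open_source.mem_nhds hq)).differentiableAt (by simp)).hasFDerivAt
  have h2 : HasFDerivAt Φ.symm (fderiv ℝ Φ.symm (Φ q)) (Φ q) :=
    ((hΨ.contDiffAt (Φ.open_target.mem_nhds (Φ.map_source hq))).differentiableAt
      (by simp)).hasFDerivAt
  have h1' : HasFDerivAt Φ (fderiv ℝ Φ q) (Φ.symm (Φ q)) := by rwa [Φ.left_inv hq]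
  have e1 := (h2.comp q h1).unique ((hasFDerivAt_id q).congr_of_eventuallyEq (by
    filter_upwards [Φ.open_source.mem_nhds hq] with t ht using Φ.left_inv ht))
  have e2 := (h1'.comp (Φ q) h2).unique ((hasFDerivAt_id (Φ q)).congr_of_eventuallyEq (by
    filter_upwards [Φ.open_target.mem_nhds (Φ.map_source hq)] with t ht using Φ.right_inv ht))
  exact ⟨DFunLike.congr_fun e1 ξ, DFunLike.congr_fun e2 ξ⟩

lemma fderiv_injective (hΦ : ContDiffOn ℝ ∞ Φ Φ.source) (hΨ : ContDiffOn ℝ ∞ Φ.symm Φ.target)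
    (hq : q ∈ Φ.source) : Function.Injective (fderiv ℝ Φ q) :=
  Function.LeftInverse.injective fun ξ => (fderiv_symm_fderiv hΦ hΨ hq ξ).1

lemma fderiv_pullback (hΦ : ContDiffOn ℝ ∞ Φ Φ.source) (hΨ : ContDiffOn ℝ ∞ Φ.symm Φ.target)
    (hq : q ∈ Φ.source) (ξ η : ℝ × ℝ × ℝ) :
    fderiv ℝ Φ q (pullback Φ q ξ η) = fderiv ℝ (fderiv ℝ Φ) q ξ η :=
  (fderiv_symm_fderiv hΦ hΨ hq _).2

lemma quad_pullbackSymbol (q ξ : ℝ × ℝ × ℝ) : quad (pullbackSymbol Φ) q ξ = pullback Φ q ξ ξ := by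
  refine ext_coord fun l => ?_
  rw [coord_quad]
  conv_rhs => rw [pullback, eq_sum_coord ξ]
  simp only [map_sum, map_smul, sum_apply, smul_apply, smul_eq_mul, pullbackSymbol, pullback,
    Finset.mul_sum]
  rw [Finset.sum_comm]
  refine Finset.sum_congr rfl fun i _ => Finset.sum_congr rfl fun j _ => ?_
  ring

lemma contDiffOn_pullbackSymbol (hΦ : ContDiffOn ℝ ∞ Φ Φ.source)
    (hΨ : ContDiffOn ℝ ∞ Φ.symm Φ.target) (l i j : Fin 3) :
    ContDiffOn ℝ ∞ (pullbackSymbol Φ l i j) Φ.source := by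
  have h1 : ContDiffOn ℝ ∞ (fderiv ℝ Φ) Φ.source :=
    hΦ.fderiv_of_isOpen Φ.open_source (m := ∞) (by simp)
  have h2 : ContDiffOn ℝ ∞ (fderiv ℝ (fderiv ℝ Φ)) Φ.source :=
    h1.fderiv_of_isOpen Φ.open_source (m := ∞) (by simp)
  have h3 : ContDiffOn ℝ ∞ (fderiv ℝ Φ.symm) Φ.target :=
    hΨ.fderiv_of_isOpen Φ.open_target (m := ∞) (by simp)
  exact (coord l).contDiff.comp_contDiffOn ((h3.comp hΦ Φ.mapsTo).clm_apply
    ((h2.clm_apply contDiffOn_const).clm_apply contDiffOn_const))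

lemma pullbackSymbol_comm (hΦ : ContDiffOn ℝ ∞ Φ Φ.source) (hq : q ∈ Φ.source) (l i j : Fin 3) :
    pullbackSymbol Φ l i j q = pullbackSymbol Φ l j i q := by
  have h : ContDiffAt ℝ 2 Φ q :=
    contDiffAt_infty.1 (hΦ.contDiffAt (Φ.open_source.mem_nhds hq)) 2
  rw [pullbackSymbol, pullback, (h.isSymmSndFDerivAt (by simp)).eq]
  rfl

lemma pd_pd_pullback (hΦ : ContDiffOn ℝ ∞ Φ Φ.source) (hΨ : ContDiffOn ℝ ∞ Φ.symm Φ.target)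
    (hq : q ∈ Φ.source) (a i j : Fin 3) :
    pd i (pd j fun t => coord a (Φ t)) q
      = ∑ l, pullbackSymbol Φ l i j q * pd l (fun t => coord a (Φ t)) q := by
  rw [pd_pd_coord_comp Φ.open_source hΦ hq, ← fderiv_pullback hΦ hΨ hq,
    eq_sum_coord (pullback Φ q _ _)]
  simp only [map_sum, map_smul, smul_eq_mul, pullbackSymbol, pd_coord_comp Φ.open_source hΦ hq]

/-- The pulled-back connection is flat: this is the symmetry of the third derivatives of `Φ`. -/
lemma curv_pullbackSymbol (hΦ : ContDiffOn ℝ ∞ Φ Φ.source) (hΨ : ContDiffOn ℝ ∞ Φ.symm Φ.target)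
    (hq : q ∈ Φ.source) (l k i j : Fin 3) : curv (pullbackSymbol Φ) l k i j q = 0 := by
  have hs : Φ.source ∈ 𝓝 q := Φ.open_source.mem_nhds hq
  have hφ : ∀ a, ContDiffOn ℝ ∞ (fun t => coord a (Φ t)) Φ.source := fun a =>
    (coord a).contDiff.comp_contDiffOn hΦ
  have hG : ∀ l i j, DifferentiableAt ℝ (pullbackSymbol Φ l i j) q := fun l i j =>
    ((contDiffOn_pullbackSymbol hΦ hΨ l i j).contDiffAt hs).differentiableAt (by simp)
  have hdφ : ∀ a l, DifferentiableAt ℝ (pd l fun t => coord a (Φ t)) q := fun a l =>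
    ((contDiffOn_pd Φ.open_source (hφ a) l).contDiffAt hs).differentiableAt (by simp)
  have h3 : ∀ a i j k, pd i (pd j (pd k fun t => coord a (Φ t))) q
      = ∑ m, (pd i (pullbackSymbol Φ m j k) q
          + ∑ l, pullbackSymbol Φ l j k q * pullbackSymbol Φ m i l q)
        * pd m (fun t => coord a (Φ t)) q := by
    intro a i j k
    rw [pd_congr i (g := fun t => ∑ l, pullbackSymbol Φ l j k t * pd l (fun t => coord a (Φ t)) t)
      (by filter_upwards [hs] with t ht using pd_pd_pullback hΦ hΨ ht a j k),
      pd_sum i _ fun l => (hG l j k).fun_mul (hdφ a l)]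
    simp only [pd_mul i (hG _ j k) (hdφ a _), pd_pd_pullback hΦ hΨ hq, Fin.sum_univ_three]
    ring
  have h4 : ∀ a, ∑ m, curv (pullbackSymbol Φ) m k i j q * pd m (fun t => coord a (Φ t)) q = 0 := by
    intro a
    have h5 := pd_comm (p := q) i j (f := pd k fun t => coord a (Φ t))
      (contDiffAt_infty.1 ((contDiffOn_pd Φ.open_source (hφ a) k).contDiffAt hs) 2)
    rw [h3, h3] at h5
    simp only [curv, Fin.sum_univ_three] at h5 ⊢
    linear_combination h5
  have h6 : fderiv ℝ Φ q (∑ m, curv (pullbackSymbol Φ) m k i j q • basisVec m) = 0 := by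
    refine ext_coord fun a => ?_
    rw [map_zero, ← h4 a]
    simp only [pd_coord_comp Φ.open_source hΦ hq, map_sum, map_smul, smul_eq_mul]
  have h7 := fderiv_injective hΦ hΨ hq (h6.trans (map_zero _).symm)
  have h8 := congrArg (coord l) h7
  simpa [map_sum, coord_basisVec] using h8

end

/-! ### Linearizable systems satisfy the conditions -/

lemma isFreeSolutionOn_affine (J : Set ℝ) (k₂ m₂ k₃ m₃ : ℝ) :
    IsFreeSolutionOn J (fun u => k₂ * u + m₂) (fun u => k₃ * u + m₃) := by
  have h : ∀ k m : ℝ, deriv (fun u : ℝ => k * u + m) = fun _ => k := by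
    intro k m
    ext u
    simp
  refine ⟨by fun_prop, by fun_prop, fun u _ => ?_⟩
  simp [h]

/-- Through every point of the source, in every direction `(1, a, b)` that `DΦ` does not map into
the hyperplane `u = 0`, there passes a graph over the `x`-axis that `Φ` carries onto a solution of
the simplest system: the preimage of a straight line. -/
lemma exists_curve_onto_line {Φ : OpenPartialHomeomorph (ℝ × ℝ × ℝ) (ℝ × ℝ × ℝ)}
    (hΦ : ContDiffOn ℝ ∞ Φ Φ.source) (hΨ : ContDiffOn ℝ ∞ Φ.symm Φ.target) {q : ℝ × ℝ × ℝ}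
    (hq : q ∈ Φ.source) {a b : ℝ} (hab : (fderiv ℝ Φ q (1, a, b)).1 ≠ 0) :
    ∃ (I J : Set ℝ) (y z v w : ℝ → ℝ), IsOpen I ∧ I.OrdConnected ∧ IsOpen J ∧ J.OrdConnected ∧
      ContDiffOn ℝ 2 y I ∧ ContDiffOn ℝ 2 z I ∧ IsFreeSolutionOn J v w ∧
      curve I y z ⊆ Φ.source ∧ Φ '' curve I y z = curve J v w ∧
      q.1 ∈ I ∧ (q.1, y q.1, z q.1) = q ∧ deriv y q.1 = a ∧ deriv z q.1 = b := by
  obtain ⟨T, hT⟩ : ∃ T, T = fderiv ℝ Φ q (1, a, b) := ⟨_, rfl⟩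
  rw [← hT] at hab
  obtain ⟨ℓ, hℓ⟩ : ∃ ℓ : ℝ → ℝ × ℝ × ℝ, ℓ = fun t => Φ q + t • T := ⟨_, rfl⟩
  have hℓc : ContDiff ℝ ∞ ℓ := by rw [hℓ]; fun_prop
  have hℓ0 : ℓ 0 = Φ q := by simp [hℓ]
  have hO : ∀ᶠ t in 𝓝 (0 : ℝ), ℓ t ∈ Φ.target :=
    hℓc.continuous.continuousAt.eventually_mem
      (Φ.open_target.mem_nhds (by rw [hℓ0]; exact Φ.map_source hq))
  obtain ⟨c, hc⟩ : ∃ c : ℝ → ℝ × ℝ × ℝ, c = fun t => Φ.symm (ℓ t) := ⟨_, rfl⟩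
  have hcs : ∀ t, ℓ t ∈ Φ.target → ContDiffAt ℝ ∞ c t := fun t ht => by
    rw [hc]
    exact (hΨ.contDiffAt (Φ.open_target.mem_nhds ht)).comp t hℓc.contDiffAt
  have hc0 : c 0 = q := by simp only [hc, hℓ0]; exact Φ.left_inv hq
  have hcd : HasDerivAt c (1, a, b) 0 := by
    have h1 : HasDerivAt ℓ T 0 := by
      rw [hℓ]
      simpa using ((hasDerivAt_id (0 : ℝ)).smul_const T).const_add (Φ q)
    have h2 : HasFDerivAt Φ.symm (fderiv ℝ Φ.symm (ℓ 0)) (ℓ 0) :=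
      ((hΨ.contDiffAt (Φ.open_target.mem_nhds hO.self_of_nhds)).differentiableAt
        (by simp)).hasFDerivAt
    have h3 := h2.comp_hasDerivAt 0 h1
    rw [hℓ0, hT, (fderiv_symm_fderiv hΦ hΨ hq _).1] at h3
    rw [hc]
    exact h3
  obtain ⟨f, hf⟩ : ∃ f : ℝ → ℝ, f = fun t => (c t).1 := ⟨_, rfl⟩
  have hfc : ContDiffAt ℝ ∞ f 0 := by
    rw [hf]
    exact (hcs 0 hO.self_of_nhds).fst
  have hfd : HasDerivAt f 1 0 := by
    rw [hf]
    exact (ContinuousLinearMap.fst ℝ ℝ (ℝ × ℝ)).hasFDerivAt.comp_hasDerivAt 0 hcd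
  have hfF := hfd.hasFDerivAt_equiv one_ne_zero
  -- The curve is reparametrized by its first coordinate `f`, whose derivative at `0` is `1`.
  let e := hfc.toOpenPartialHomeomorph f hfF (by simp)
  have he : ∀ t, e t = f t := fun t => rfl
  have he0 : (0 : ℝ) ∈ e.source := hfc.mem_toOpenPartialHomeomorph_source hfF (by simp)
  have hf0 : f 0 = q.1 := by simp only [hf, hc0]
  have hqt : q.1 ∈ e.target := by rw [← hf0]; exact e.map_source he0
  have hg0 : e.symm q.1 = 0 := by rw [← hf0]; exact e.left_inv he0
  have hgc : ContDiffAt ℝ ∞ e.symm q.1 :=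
    e.contDiffAt_symm_deriv one_ne_zero hqt (by rw [hg0]; exact hfd) (by rw [hg0]; exact hfc)
  have hgd : HasDerivAt e.symm 1 q.1 := by
    have := e.hasDerivAt_symm hqt (f' := 1) one_ne_zero (by rw [hg0]; exact hfd)
    simpa using this
  have hev : ∀ᶠ x in 𝓝 q.1, x ∈ e.target ∧ ℓ (e.symm x) ∈ Φ.target ∧
      ContDiffAt ℝ 2 e.symm x := by
    refine (show ∀ᶠ x in 𝓝 q.1, x ∈ e.target from e.open_target.mem_nhds hqt).and (.and ?_ ?_)
    · exact hgc.continuousAt.eventually (by rw [hg0]; exact hO)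
    · exact (contDiffAt_infty.1 hgc 2).eventually (by simp)
  obtain ⟨ε, hε, hball⟩ := Metric.eventually_nhds_iff_ball.1 hev
  obtain ⟨I, hI⟩ : ∃ I, I = Metric.ball q.1 ε := ⟨_, rfl⟩
  rw [← hI] at hball
  have hIo : IsOpen I := by rw [hI]; exact Metric.isOpen_ball
  have hIp : IsPreconnected I := by
    rw [hI, Real.ball_eq_Ioo]; exact isPreconnected_Ioo
  have hqI : q.1 ∈ I := by rw [hI]; exact Metric.mem_ball_self hε
  have hcg : ∀ x ∈ I, ((c (e.symm x)).1, (c (e.symm x)).2.1, (c (e.symm x)).2.2) = c (e.symm x) :=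
    fun x _ => rfl
  have hcg1 : ∀ x ∈ I, (c (e.symm x)).1 = x := by
    intro x hx
    have := e.right_inv (hball x hx).1
    rw [he, hf] at this
    exact this
  have hcx : ∀ x ∈ I, (x, (c (e.symm x)).2.1, (c (e.symm x)).2.2) = c (e.symm x) := by
    intro x hx
    refine Prod.ext (hcg1 x hx).symm rfl
  have hΦc : ∀ x ∈ I, Φ (c (e.symm x)) = Φ q + e.symm x • T := by
    intro x hx
    have := Φ.right_inv (hball x hx).2.1
    simp only [hc]
    rw [this, hℓ]
  have hcd2 : ContDiffOn ℝ 2 (fun x => c (e.symm x)) I := fun x hx =>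
    ((contDiffAt_infty.1 (hcs _ (hball x hx).2.1) 2).comp x (hball x hx).2.2).contDiffWithinAt
  obtain ⟨h, hh⟩ : ∃ h : ℝ → ℝ, h = fun t => (Φ q).1 + t * T.1 := ⟨_, rfl⟩
  have hcgd : HasDerivAt (fun x => c (e.symm x)) (1, a, b) q.1 := by
    have h1 : HasDerivAt c (1, a, b) (e.symm q.1) := by rw [hg0]; exact hcd
    have h2 := h1.scomp q.1 hgd
    rw [one_smul] at h2
    exact h2
  refine ⟨I, h '' (e.symm '' I), fun x => (c (e.symm x)).2.1, fun x => (c (e.symm x)).2.2,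
    fun u => T.2.1 / T.1 * u + ((Φ q).2.1 - T.2.1 / T.1 * (Φ q).1),
    fun u => T.2.2 / T.1 * u + ((Φ q).2.2 - T.2.2 / T.1 * (Φ q).1),
    hIo, hIp.ordConnected, ?_, ?_, hcd2.snd.fst, hcd2.snd.snd, isFreeSolutionOn_affine _ _ _ _ _,
    ?_, ?_, hqI, ?_, ?_, ?_⟩
  · have h1 : IsOpen (e.symm '' I) :=
      e.isOpen_image_symm_of_subset_target hIo fun x hx => (hball x hx).1
    have h2 : h = (Homeomorph.mulRight₀ T.1 hab).trans (Homeomorph.addLeft (Φ q).1) := by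
      rw [hh]; rfl
    rw [h2]
    exact (Homeomorph.isOpenMap _) _ h1
  · have h1 : IsPreconnected (e.symm '' I) :=
      hIp.image _ fun x hx => (hball x hx).2.2.continuousAt.continuousWithinAt
    have h2 : Continuous h := by rw [hh]; fun_prop
    exact (h1.image _ h2.continuousOn).ordConnected
  · rintro _ ⟨x, hx, rfl⟩
    simp only [hcx x hx]
    simp only [hc]
    exact Φ.map_target (hball x hx).2.1
  · simp only [curve, image_image]
    refine image_congr fun x hx => ?_
    rw [hcx x hx, hΦc x hx, hh]
    refine Prod.ext ?_ (Prod.ext ?_ ?_)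
    · simp
    · simp only [Prod.snd_add, Prod.fst_add, Prod.smul_snd, Prod.smul_fst, smul_eq_mul]
      field_simp
      ring
    · simp only [Prod.snd_add, Prod.smul_snd, smul_eq_mul]
      field_simp
      ring
  · simp only [hcx _ hqI]
    rw [hg0, hc0]
  · exact ((ContinuousLinearMap.fst ℝ ℝ ℝ ∘L
      ContinuousLinearMap.snd ℝ ℝ (ℝ × ℝ)).hasFDerivAt.comp_hasDerivAt q.1 hcgd).deriv
  · exact ((ContinuousLinearMap.snd ℝ ℝ ℝ ∘L
      ContinuousLinearMap.snd ℝ ℝ (ℝ × ℝ)).hasFDerivAt.comp_hasDerivAt q.1 hcgd).deriv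

/-- A continuous function of the direction `(1, a, b)` that vanishes off the kernel of a non-zero
linear form vanishes identically. -/
lemma eq_zero_of_eq_zero_off_kernel {L : ℝ × ℝ × ℝ →L[ℝ] ℝ} (hL : L ≠ 0) {f : ℝ → ℝ → ℝ}
    (hf : Continuous fun p : ℝ × ℝ => f p.1 p.2) (h : ∀ a b, L (1, a, b) ≠ 0 → f a b = 0)
    (a b : ℝ) : f a b = 0 := by
  by_cases h0 : L (1, a, b) = 0
  swap
  · exact h a b h0
  obtain ⟨d, e, hde⟩ : ∃ d e, L (0, d, e) ≠ 0 := by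
    by_contra! hcon
    refine hL (ContinuousLinearMap.ext fun ξ => ?_)
    have : ξ = ξ.1 • (1, a, b) + (0, ξ.2.1 - ξ.1 * a, ξ.2.2 - ξ.1 * b) := by
      refine Prod.ext ?_ (Prod.ext ?_ ?_) <;> simp
    rw [this, map_add, map_smul, h0, hcon]
    simp
  have hc : Continuous fun s : ℝ => f (a + s * d) (b + s * e) :=
    hf.comp (f := fun s : ℝ => (a + s * d, b + s * e)) (by fun_prop)
  have := Continuous.ext_on (dense_compl_singleton (0 : ℝ)) hc (continuous_const (y := (0 : ℝ)))
    (fun s hs => h _ _ (by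
      have e1 : ((1, a + s * d, b + s * e) : ℝ × ℝ × ℝ) = (1, a, b) + s • (0, d, e) := by simp
      rw [e1, map_add, map_smul, h0, zero_add]
      exact smul_ne_zero hs hde))
  simpa using congrFun this 0

lemma System.MapsToFree.isRepresentedBy {S : System}
    {Φ : OpenPartialHomeomorph (ℝ × ℝ × ℝ) (ℝ × ℝ × ℝ)} (hS : S.MapsToFree Φ)
    (hΦ : ContDiffOn ℝ ∞ Φ Φ.source) (hΨ : ContDiffOn ℝ ∞ Φ.symm Φ.target) {q : ℝ × ℝ × ℝ}
    (hq : q ∈ Φ.source) : S.IsRepresentedBy (pullbackSymbol Φ) q := by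
  have hsym : ∀ l i j, pullbackSymbol Φ l i j q = pullbackSymbol Φ l j i q :=
    pullbackSymbol_comm hΦ hq
  obtain ⟨L, hL⟩ : ∃ L : ℝ × ℝ × ℝ →L[ℝ] ℝ,
      L = ContinuousLinearMap.fst ℝ ℝ (ℝ × ℝ) ∘L fderiv ℝ Φ q := ⟨_, rfl⟩
  have hL0 : L ≠ 0 := by
    intro h
    have h1 := DFunLike.congr_fun h (fderiv ℝ Φ.symm (Φ q) (1, 0, 0))
    rw [hL, ContinuousLinearMap.comp_apply, (fderiv_symm_fderiv hΦ hΨ hq _).2] at h1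
    exact one_ne_zero h1
  have key : ∀ a b, L (1, a, b) ≠ 0 →
      S.rhs2 q a b = (quad (pullbackSymbol Φ) q (1, a, b)).2.1
        - (quad (pullbackSymbol Φ) q (1, a, b)).1 * a ∧
      S.rhs3 q a b = (quad (pullbackSymbol Φ) q (1, a, b)).2.2
        - (quad (pullbackSymbol Φ) q (1, a, b)).1 * b := by
    intro a b hab
    rw [hL] at hab
    obtain ⟨I, J, y, z, v, w, hI, hIc, hJ, hJc, hy, hz, hfree, hsub, himg, hqI, hqe, rfl, rfl⟩ :=
      exists_curve_onto_line hΦ hΨ hq hab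
    have hsol := (hS I J y z v w hI hIc hJ hJc hy hz hfree.1 hfree.2.1 hsub himg).2 hfree
    have h1 := (S.isSolutionOn_iff hy hz).1 hsol q.1 hqI
    have hgraph : ∀ x ∈ I, ∃ u ∈ J, Φ (x, y x, z x) = (u, v u, w u) := by
      intro x hx
      have : Φ (x, y x, z x) ∈ curve J v w := by
        rw [← himg]; exact ⟨_, ⟨x, hx, rfl⟩, rfl⟩
      obtain ⟨u, hu, he⟩ := this
      exact ⟨u, hu, he.symm⟩
    obtain ⟨u, hu, hue⟩ := hgraph q.1 hqI
    have h2 := (free_iff_geodesic hI hJ hqI hy hz hfree.1 hfree.2.1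
      (fun t ht => contDiffAt_infty.1
        (hΦ.contDiffAt (Φ.open_source.mem_nhds (hsub ⟨t, ht, rfl⟩))) 2)
      (by rw [hqe]; exact fderiv_injective hΦ hΨ hq) hgraph
      (n := pullback Φ q (1, deriv y q.1, deriv z q.1) (1, deriv y q.1, deriv z q.1))
      (by rw [hqe]; exact (fderiv_pullback hΦ hΨ hq _ _).symm)).1
        (by rw [hue]; exact hfree.2.2 u hu)
    rw [hqe] at h1
    rw [quad_pullbackSymbol]
    constructor <;> linarith [h1.1, h1.2, h2.1, h2.2]
  have hcont : Continuous fun p : ℝ × ℝ => quad (pullbackSymbol Φ) q (1, p.1, p.2) := by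
    simp only [quad]
    fun_prop
  refine S.isRepresentedBy_of_rhs_eq hsym (fun a b => ?_) fun a b => ?_
  · refine sub_eq_zero.1 (eq_zero_of_eq_zero_off_kernel hL0
      (f := fun a b => S.rhs2 q a b - ((quad (pullbackSymbol Φ) q (1, a, b)).2.1
        - (quad (pullbackSymbol Φ) q (1, a, b)).1 * a)) ?_
      (fun a b hab => sub_eq_zero.2 (key a b hab).1) a b)
    simp only [System.rhs2]
    fun_prop
  · refine sub_eq_zero.1 (eq_zero_of_eq_zero_off_kernel hL0
      (f := fun a b => S.rhs3 q a b - ((quad (pullbackSymbol Φ) q (1, a, b)).2.2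
        - (quad (pullbackSymbol Φ) q (1, a, b)).1 * b)) ?_
      (fun a b hab => sub_eq_zero.2 (key a b hab).2) a b)
    simp only [System.rhs3]
    fun_prop

theorem System.LinearizableAt.fifteenConditions {S : System} {U : Set (ℝ × ℝ × ℝ)}
    {p : ℝ × ℝ × ℝ} (h : S.LinearizableAt U p) : S.FifteenConditions p := by
  obtain ⟨Φ, hp, -, hΦ, hΨ, hS⟩ := h
  have hs : ∀ᶠ q in 𝓝 p, q ∈ Φ.source := Φ.open_source.mem_nhds hp
  exact System.fifteenConditions_of_curv_eq_zero
    (fun l i j => hs.mono fun q hq => pullbackSymbol_comm hΦ hq l i j)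
    (hs.mono fun q hq => hS.isRepresentedBy hΦ hΨ hq)
    (fun l i j => ((contDiffOn_pullbackSymbol hΦ hΨ l i j).contDiffAt hs).differentiableAt
      (by simp))
    (curv_pullbackSymbol hΦ hΨ hp)

/-! ### The conditions as the vanishing of the projective curvature -/

/-- Half the Ricci tensor: the projective Schouten tensor, in dimension three, of a connection with
symmetric Ricci tensor. -/
noncomputable def schouten (G : Fin 3 → Fin 3 → Fin 3 → ℝ × ℝ × ℝ → ℝ) (i j : Fin 3)
    (p : ℝ × ℝ × ℝ) : ℝ :=
  1 / 2 * ∑ l, curv G l i l j p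

/-- The curvature of a projectively flat connection, `δ^l_i P_{jk} - δ^l_j P_{ik}`, where `P` is
the Schouten tensor. -/
noncomputable def projCurv (G : Fin 3 → Fin 3 → Fin 3 → ℝ × ℝ × ℝ → ℝ) (l k i j : Fin 3)
    (p : ℝ × ℝ × ℝ) : ℝ :=
  (if l = i then schouten G j k p else 0) - (if l = j then schouten G i k p else 0)

section

variable {S : System} {G : Fin 3 → Fin 3 → Fin 3 → ℝ × ℝ × ℝ → ℝ} {p : ℝ × ℝ × ℝ}

lemma curv_antisymm (G : Fin 3 → Fin 3 → Fin 3 → ℝ × ℝ × ℝ → ℝ) (l k i j : Fin 3)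
    (p : ℝ × ℝ × ℝ) : curv G l k j i p = -curv G l k i j p := by
  simp only [curv, Fin.sum_univ_three]
  ring

lemma projCurv_antisymm (G : Fin 3 → Fin 3 → Fin 3 → ℝ × ℝ × ℝ → ℝ) (l k i j : Fin 3)
    (p : ℝ × ℝ × ℝ) : projCurv G l k j i p = -projCurv G l k i j p := by
  simp only [projCurv]
  ring

/-- The consequences, at a point, of the symmetry of a connection and of the vanishing of the
trace of its Christoffel symbols. -/
structure TraceFreeAt (G : Fin 3 → Fin 3 → Fin 3 → ℝ × ℝ × ℝ → ℝ) (p : ℝ × ℝ × ℝ) : Prop where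
  symm : ∀ l i j, G l i j p = G l j i p
  pd_symm : ∀ a l i j, pd a (G l i j) p = pd a (G l j i) p
  trace : ∀ i, ∑ l, G l i l p = 0
  pd_trace : ∀ a i, ∑ l, pd a (G l i l) p = 0

lemma TraceFreeAt.eqs (h : TraceFreeAt G p) :
    (G 0 0 0 p = -G 1 0 1 p - G 2 0 2 p ∧ G 1 1 1 p = -G 0 0 1 p - G 2 1 2 p ∧
      G 2 2 2 p = -G 0 0 2 p - G 1 1 2 p) ∧
    (∀ a, pd a (G 0 0 0) p = -pd a (G 1 0 1) p - pd a (G 2 0 2) p) ∧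
    (∀ a, pd a (G 1 1 1) p = -pd a (G 0 0 1) p - pd a (G 2 1 2) p) ∧
    ∀ a, pd a (G 2 2 2) p = -pd a (G 0 0 2) p - pd a (G 1 1 2) p := by
  have ht := h.trace
  have hd := h.pd_trace
  simp only [Fin.sum_univ_three] at ht hd
  refine ⟨⟨by linarith [ht 0], by linarith [ht 1, h.symm 0 1 0],
    by linarith [ht 2, h.symm 0 2 0, h.symm 1 2 1]⟩, fun a => by linarith [hd a 0],
    fun a => by linarith [hd a 1, h.pd_symm a 0 1 0],
    fun a => by linarith [hd a 2, h.pd_symm a 0 2 0, h.pd_symm a 1 2 1]⟩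

lemma schouten_symm (h : TraceFreeAt G p) (i j : Fin 3) : schouten G i j p = schouten G j i p := by
  obtain ⟨⟨t0, t1, t2⟩, d0, d1, d2⟩ := h.eqs
  have hs := h.symm
  have hd := h.pd_symm
  fin_cases i <;> fin_cases j <;>
    simp only [schouten, curv, Fin.sum_univ_three, Fin.zero_eta, Fin.mk_one,
      Fin.reduceFinMk, Fin.isValue, hs _ 1 0, hs _ 2 0, hs _ 2 1,
      hd _ _ 1 0, hd _ _ 2 0, hd _ _ 2 1, t0, t1, t2, d0, d1, d2] <;>
    ring

set_option linter.unusedSimpArgs false in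
/-- For the trace-free connection representing the system, the fifteen conditions say that the
curvature is determined by the Schouten tensor, i.e. that Weyl's projective curvature tensor
vanishes: each component of the latter is a linear combination of the fifteen expressions. -/
lemma System.FifteenConditions.curv_eq (hC : S.FifteenConditions p) (h : TraceFreeAt G p)
    (hrep : ∀ᶠ q in 𝓝 p, S.IsRepresentedBy G q) (hG : ∀ l i j, DifferentiableAt ℝ (G l i j) p)
    (l k i j : Fin 3) : curv G l k i j p = projCurv G l k i j p := by
  obtain ⟨⟨t0, t1, t2⟩, d0, d1, d2⟩ := h.eqs
  have hs := h.symm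
  have hd := h.pd_symm
  have he := hrep.self_of_nhds
  have hx := System.IsRepresentedBy.pd hrep hG 0
  have hy := System.IsRepresentedBy.pd hrep hG 1
  have hz := System.IsRepresentedBy.pd hrep hG 2
  have hdx : dx = CubicODE.pd 0 := rfl
  have hdy : dy = CubicODE.pd 1 := rfl
  have hdz : dz = CubicODE.pd 2 := rfl
  simp only [System.IsRepresentedBy, System.pd] at he hx hy hz
  simp only [System.FifteenConditions, hdx, hdy, hdz, he, hx, hy, hz, t0, t1, t2, d0, d1, d2]
    at hC
  obtain ⟨c1, c2, c3, c4, c5, c6, c7, c8, c9, c10, c11, c12, c13, c14, c15⟩ := hC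
  have h01 : ∀ l k, curv G l k 0 1 p = projCurv G l k 0 1 p := by
    intro l k
    fin_cases l <;> fin_cases k <;>
      simp only [projCurv, schouten, curv, Fin.sum_univ_three, Fin.zero_eta, Fin.mk_one,
        Fin.reduceFinMk, Fin.isValue, Fin.reduceEq, reduceIte, hs _ 1 0, hs _ 2 0, hs _ 2 1,
        hd _ _ 1 0, hd _ _ 2 0, hd _ _ 2 1, t0, t1, t2, d0, d1, d2]
    · linear_combination (-5/8) * c3 + (1/2) * c10
    · linear_combination (1/2) * c11
    · linear_combination (-1/8) * c8 + (5/16) * c13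
    · linear_combination (-1/2) * c12
    · linear_combination (-1/8) * c3 + (-1/2) * c10
    · linear_combination (1/4) * c14 + (-3/8) * c15
    · linear_combination c1
    · linear_combination c2
    · linear_combination (3/4) * c3
  have h02 : ∀ l k, curv G l k 0 2 p = projCurv G l k 0 2 p := by
    intro l k
    fin_cases l <;> fin_cases k <;>
      simp only [projCurv, schouten, curv, Fin.sum_univ_three, Fin.zero_eta, Fin.mk_one,
        Fin.reduceFinMk, Fin.isValue, Fin.reduceEq, reduceIte, hs _ 1 0, hs _ 2 0, hs _ 2 1,
        hd _ _ 1 0, hd _ _ 2 0, hd _ _ 2 1, t0, t1, t2, d0, d1, d2]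
    · linear_combination (-1/4) * c14 + (-1/8) * c15
    · linear_combination (5/8) * c8 + (-1/16) * c13
    · linear_combination (1/2) * c9
    · linear_combination c4
    · linear_combination (1/2) * c14 + (-1/4) * c15
    · linear_combination c5
    · linear_combination (1/2) * c12
    · linear_combination (1/8) * c3 + (1/2) * c10
    · linear_combination (-1/4) * c14 + (3/8) * c15
  have h12 : ∀ l k, curv G l k 1 2 p = projCurv G l k 1 2 p := by
    intro l k
    fin_cases l <;> fin_cases k <;>
      simp only [projCurv, schouten, curv, Fin.sum_univ_three, Fin.zero_eta, Fin.mk_one,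
        Fin.reduceFinMk, Fin.isValue, Fin.reduceEq, reduceIte, hs _ 1 0, hs _ 2 0, hs _ 2 1,
        hd _ _ 1 0, hd _ _ 2 0, hd _ _ 2 1, t0, t1, t2, d0, d1, d2]
    · linear_combination (3/4) * c8 + (-3/8) * c13
    · linear_combination c6
    · linear_combination c7
    · linear_combination (1/4) * c14 + (1/8) * c15
    · linear_combination (-5/8) * c8 + (1/16) * c13
    · linear_combination (-1/2) * c9
    · linear_combination (-5/8) * c3 + (1/2) * c10
    · linear_combination (1/2) * c11
    · linear_combination (-1/8) * c8 + (5/16) * c13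
  have hdiag : ∀ i, curv G l k i i p = projCurv G l k i i p := by
    intro i
    have h1 := curv_antisymm G l k i i p
    have h2 := projCurv_antisymm G l k i i p
    linarith
  have hanti : ∀ i j, curv G l k i j p = projCurv G l k i j p →
      curv G l k j i p = projCurv G l k j i p := by
    intro i j hij
    rw [curv_antisymm G l k i j, hij, projCurv_antisymm G l k i j]
  fin_cases i <;> fin_cases j
  exacts [hdiag 0, h01 l k, h02 l k, hanti 0 1 (h01 l k), hdiag 1, h12 l k, hanti 0 2 (h02 l k),
    hanti 1 2 (h12 l k), hdiag 2]

end

/-! ### The Bianchi identity and the Cotton tensor -/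

section

variable {G : Fin 3 → Fin 3 → Fin 3 → ℝ × ℝ × ℝ → ℝ} {U : Set (ℝ × ℝ × ℝ)} {q : ℝ × ℝ × ℝ}

lemma contDiffOn_curv (hU : IsOpen U) (hG : ∀ l i j, ContDiffOn ℝ ∞ (G l i j) U)
    (l k i j : Fin 3) : ContDiffOn ℝ ∞ (curv G l k i j) U :=
  ((contDiffOn_pd hU (hG l j k) i).sub (contDiffOn_pd hU (hG l i k) j)).add
    (ContDiffOn.sum fun a _ => ((hG l i a).mul (hG a j k)).sub ((hG l j a).mul (hG a i k)))

lemma contDiffOn_schouten (hU : IsOpen U) (hG : ∀ l i j, ContDiffOn ℝ ∞ (G l i j) U)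
    (i j : Fin 3) : ContDiffOn ℝ ∞ (schouten G i j) U :=
  contDiffOn_const.mul (ContDiffOn.sum fun l _ => contDiffOn_curv hU hG l i l j)

lemma pd_curv (hU : IsOpen U) (hG : ∀ l i j, ContDiffOn ℝ ∞ (G l i j) U) (hq : q ∈ U)
    (m l k i j : Fin 3) :
    pd m (curv G l k i j) q = pd m (pd i (G l j k)) q - pd m (pd j (G l i k)) q
      + ∑ a, (G l i a q * pd m (G a j k) q + pd m (G l i a) q * G a j k q
        - (G l j a q * pd m (G a i k) q + pd m (G l j a) q * G a i k q)) := by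
  have hd : ∀ {f : ℝ × ℝ × ℝ → ℝ}, ContDiffOn ℝ ∞ f U → DifferentiableAt ℝ f q := fun hf =>
    (hf.contDiffAt (hU.mem_nhds hq)).differentiableAt (by simp)
  have hGd : ∀ l i j, DifferentiableAt ℝ (G l i j) q := fun l i j => hd (hG l i j)
  have hP : ∀ m l i j, DifferentiableAt ℝ (pd m (G l i j)) q :=
    fun m l i j => hd (contDiffOn_pd hU (hG l i j) m)
  have e : curv G l k i j = fun p => (pd i (G l j k) p - pd j (G l i k) p) +
    ∑ a, (G l i a p * G a j k p - G l j a p * G a i k p) := rfl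
  rw [e, pd_add m ((hP _ _ _ _).fun_sub (hP _ _ _ _))
    (DifferentiableAt.fun_sum fun a _ =>
      ((hGd _ _ _).fun_mul (hGd _ _ _)).fun_sub ((hGd _ _ _).fun_mul (hGd _ _ _))),
    pd_sub m (hP _ _ _ _) (hP _ _ _ _),
    pd_sum m _ fun a => ((hGd _ _ _).fun_mul (hGd _ _ _)).fun_sub ((hGd _ _ _).fun_mul (hGd _ _ _))]
  congr 1
  refine Finset.sum_congr rfl fun a _ => ?_
  rw [pd_sub m ((hGd _ _ _).fun_mul (hGd _ _ _)) ((hGd _ _ _).fun_mul (hGd _ _ _)),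
    pd_mul m (hGd _ _ _) (hGd _ _ _), pd_mul m (hGd _ _ _) (hGd _ _ _)]
  ring

/-- The second Bianchi identity `d_A F = 0` for the curvature `F` of the connection form `A`. -/
lemma bianchi (hU : IsOpen U) (hG : ∀ l i j, ContDiffOn ℝ ∞ (G l i j) U) (hq : q ∈ U)
    (m l k i j : Fin 3) :
    pd m (curv G l k i j) q + pd i (curv G l k j m) q + pd j (curv G l k m i) q
      + ∑ a, (G l m a q * curv G a k i j q - G a m k q * curv G l a i j q)
      + ∑ a, (G l i a q * curv G a k j m q - G a i k q * curv G l a j m q)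
      + ∑ a, (G l j a q * curv G a k m i q - G a j k q * curv G l a m i q) = 0 := by
  have hc : ∀ a b l i j, pd a (pd b (G l i j)) q = pd b (pd a (G l i j)) q := fun a b l i j =>
    pd_comm a b (contDiffAt_infty.1 ((hG l i j).contDiffAt (hU.mem_nhds hq)) 2)
  simp only [pd_curv hU hG hq]
  rw [hc m i, hc j m, hc i j]
  simp only [curv, Fin.sum_univ_three]
  ring

/-- The vanishing of Weyl's tensor forces that of the Cotton tensor, the alternated covariant
derivative of the Schouten tensor: this is a component of the Bianchi identity. -/
lemma cotton_eq_zero (hU : IsOpen U) (hG : ∀ l i j, ContDiffOn ℝ ∞ (G l i j) U)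
    (hsym : ∀ l i j, ∀ q ∈ U, G l i j q = G l j i q)
    (hW : ∀ q ∈ U, ∀ l k i j, curv G l k i j q = projCurv G l k i j q) (hq : q ∈ U)
    (i j k : Fin 3) :
    pd i (schouten G j k) q + ∑ a, G a j k q * schouten G i a q
      = pd j (schouten G i k) q + ∑ a, G a i k q * schouten G j a q := by
  have hpd : ∀ m l k i j, pd m (curv G l k i j) q = pd m (projCurv G l k i j) q :=
    fun m l k i j => pd_congr m <| by
      filter_upwards [hU.mem_nhds hq] with r hr using hW r hr l k i j
  have hs : ∀ l i j, G l i j q = G l j i q := fun l i j => hsym l i j q hq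
  -- The component of the identity that is needed has its upper index different from `i` and `j`.
  have key : ∀ t i j, t ≠ i → t ≠ j → i ≠ j →
      pd i (schouten G j k) q + ∑ a, G a j k q * schouten G i a q
      = pd j (schouten G i k) q + ∑ a, G a i k q * schouten G j a q := by
    intro t i j hti htj hij
    have e1 : projCurv G t k i j = fun _ => 0 := by
      funext r; simp [projCurv, hti, htj]
    have e2 : projCurv G t k j t = fun r => -schouten G j k r := by
      funext r; simp [projCurv, htj]
    have e3 : projCurv G t k t i = schouten G i k := by
      funext r; simp [projCurv, hti]
    have hb := bianchi hU hG hq t t k i j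
    rw [hpd, hpd, hpd, e1, e2, e3, pd_const, pd_neg] at hb
    simp only [hW q hq, projCurv, Finset.sum_sub_distrib, mul_sub, mul_ite, mul_zero,
      Finset.sum_ite_eq', Finset.mem_univ, if_true, hti, htj, if_false] at hb
    simp only [Finset.sum_const_zero, sub_zero, zero_sub] at hb
    rw [hs t i t, hs t j t, hs t j i] at hb
    linarith
  rcases eq_or_ne i j with rfl | hij
  · rfl
  · obtain ⟨t, hti, htj⟩ : ∃ t : Fin 3, t ≠ i ∧ t ≠ j := by
      revert i j
      decide
    exact key t i j hti htj hij

end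

/-! ### The trace-free connection of a system -/

section

variable {S : System} {U : Set (ℝ × ℝ × ℝ)} {q : ℝ × ℝ × ℝ}

/-- The only symmetric connection with trace-free Christoffel symbols (Thomas's normalization)
that represents the system. -/
noncomputable def System.christoffel (S : System) : Fin 3 → Fin 3 → Fin 3 → ℝ × ℝ × ℝ → ℝ :=
  ![![![fun q => -1 / 4 * (S.C22 q + S.C33 q), fun q => -1 / 4 * (S.B222 q + S.B323 q),
        fun q => -1 / 4 * (S.B223 q + S.B333 q)],
      ![fun q => -1 / 4 * (S.B222 q + S.B323 q), fun q => -S.A22 q, fun q => -S.A23 q],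
      ![fun q => -1 / 4 * (S.B223 q + S.B333 q), fun q => -S.A23 q, fun q => -S.A33 q]],
    ![![S.D2, fun q => 1 / 8 * (3 * S.C22 q - S.C33 q), fun q => 1 / 2 * S.C23 q],
      ![fun q => 1 / 8 * (3 * S.C22 q - S.C33 q), fun q => 1 / 2 * (S.B222 q - S.B323 q),
        fun q => 1 / 4 * (3 * S.B223 q - S.B333 q)],
      ![fun q => 1 / 2 * S.C23 q, fun q => 1 / 4 * (3 * S.B223 q - S.B333 q), S.B233]],
    ![![S.D3, fun q => 1 / 2 * S.C32 q, fun q => 1 / 8 * (3 * S.C33 q - S.C22 q)],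
      ![fun q => 1 / 2 * S.C32 q, S.B322, fun q => 1 / 4 * (3 * S.B323 q - S.B222 q)],
      ![fun q => 1 / 8 * (3 * S.C33 q - S.C22 q), fun q => 1 / 4 * (3 * S.B323 q - S.B222 q),
        fun q => 1 / 2 * (S.B333 q - S.B223 q)]]]

lemma System.isRepresentedBy_christoffel (S : System) (q : ℝ × ℝ × ℝ) :
    S.IsRepresentedBy S.christoffel q := by
  simp only [System.IsRepresentedBy, System.christoffel, Matrix.cons_val]
  refine ⟨?_, ?_, ?_, ?_, ?_, ?_, ?_, ?_, ?_, ?_, ?_, ?_, ?_, ?_, ?_⟩ <;> first | trivial | ring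

lemma System.christoffel_symm (S : System) (l i j : Fin 3) :
    S.christoffel l i j = S.christoffel l j i := by
  fin_cases l <;> fin_cases i <;> fin_cases j <;> rfl

lemma System.christoffel_trace (S : System) (i : Fin 3) (q : ℝ × ℝ × ℝ) :
    ∑ l, S.christoffel l i l q = 0 := by
  fin_cases i <;> simp [System.christoffel, Fin.sum_univ_three] <;> ring

lemma System.SmoothOn.christoffel (hS : S.SmoothOn U) (l i j : Fin 3) :
    ContDiffOn ℝ ∞ (S.christoffel l i j) U := by
  obtain ⟨h1, h2, h3, h4, h5, h6, h7, h8, h9, h10, h11, h12, h13, h14, h15⟩ := hS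
  fin_cases l <;> fin_cases i <;> fin_cases j <;>
    simp only [System.christoffel, Fin.zero_eta, Fin.mk_one, Fin.reduceFinMk, Matrix.cons_val] <;>
    fun_prop

lemma System.SmoothOn.traceFreeAt (hU : IsOpen U) (hS : S.SmoothOn U) (hq : q ∈ U) :
    TraceFreeAt S.christoffel q where
  symm l i j := by rw [S.christoffel_symm]
  pd_symm a l i j := by rw [S.christoffel_symm]
  trace i := S.christoffel_trace i q
  pd_trace a i := by
    rw [← pd_sum a Finset.univ fun l =>
      ((hS.christoffel l i l).contDiffAt (hU.mem_nhds hq)).differentiableAt (by simp)]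
    simp only [S.christoffel_trace, pd_const]

end

/-! ### Projective flatness gives linearizing coordinates -/

/-- The connection form of the projective cotractor connection: its parallel sections are the
`1`-jets `(σ, ∂σ)` of the solutions of `∂ᵢ ∂ⱼ σ = ∑ l, G^l_{ij} ∂ₗ σ - P_{ij} σ`. The index `none`
stands for the component `σ`. -/
noncomputable def tractor (G : Fin 3 → Fin 3 → Fin 3 → ℝ × ℝ × ℝ → ℝ) (i : Fin 3) :
    Option (Fin 3) → Option (Fin 3) → ℝ × ℝ × ℝ → ℝ
  | none, none => fun _ => 0
  | none, some j => fun _ => if i = j then 1 else 0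
  | some k, none => fun q => -schouten G i k q
  | some k, some l => G l i k

section

variable {G : Fin 3 → Fin 3 → Fin 3 → ℝ × ℝ × ℝ → ℝ} {U : Set (ℝ × ℝ × ℝ)} {p q : ℝ × ℝ × ℝ}

lemma contDiffOn_tractor (hU : IsOpen U) (hG : ∀ l i j, ContDiffOn ℝ ∞ (G l i j) U) (i : Fin 3) :
    ∀ a b, ContDiffOn ℝ ∞ (tractor G i a b) U
  | none, none => contDiffOn_const
  | none, some _ => contDiffOn_const
  | some k, none => (contDiffOn_schouten hU hG i k).neg
  | some k, some l => hG l i k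

/-- The curvature of the tractor connection consists of Weyl's tensor and the Cotton tensor. -/
lemma tractor_compatible (hU : IsOpen U) (hG : ∀ l i j, ContDiffOn ℝ ∞ (G l i j) U)
    (htf : ∀ q ∈ U, TraceFreeAt G q)
    (hW : ∀ q ∈ U, ∀ l k i j, curv G l k i j q = projCurv G l k i j q) (hq : q ∈ U)
    (i j : Fin 3) (a b : Option (Fin 3)) :
    pd i (tractor G j a b) q + ∑ c, tractor G j a c q * tractor G i c b q
      = pd j (tractor G i a b) q + ∑ c, tractor G i a c q * tractor G j c b q := by
  have hP := schouten_symm (htf q hq)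
  have hs := (htf q hq).symm
  match a, b with
  | none, none =>
    simp [tractor, Fintype.sum_option, pd_const, hP i j]
  | none, some l =>
    simp [tractor, Fintype.sum_option, pd_const, hs l i j]
  | some k, none =>
    have hc := cotton_eq_zero hU hG (fun l i j r hr => (htf r hr).symm l i j) hW hq i j k
    simp only [tractor, Fintype.sum_option, pd_neg, mul_neg, Finset.sum_neg_distrib, mul_zero,
      zero_add]
    linarith
  | some k, some l =>
    have hc := hW q hq l k i j
    simp only [curv, projCurv, Finset.sum_sub_distrib] at hc
    simp only [tractor, Fintype.sum_option, mul_ite, mul_one, mul_zero, @eq_comm _ i l,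
      @eq_comm _ j l]
    have e : ∀ i j, ∑ c, G c j k q * G l i c q = ∑ c, G l i c q * G c j k q := fun i j =>
      Finset.sum_congr rfl fun c _ => mul_comm _ _
    rw [e i j, e j i]
    split_ifs at hc ⊢ <;> linarith

/-- A projective change of a connection does not affect its unparametrized geodesics. -/
lemma System.IsRepresentedBy.projective_change {S : System} (h : S.IsRepresentedBy G q)
    (ψ : Fin 3 → ℝ × ℝ × ℝ → ℝ) :
    S.IsRepresentedBy (fun l i j r =>
      G l i j r - ((if l = i then ψ j r else 0) + if l = j then ψ i r else 0)) q := by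
  obtain ⟨e1, e2, e3, e4, e5, e6, e7, e8, e9, e10, e11, e12, e13, e14, e15⟩ := h
  simp only [System.IsRepresentedBy, Fin.isValue, Fin.reduceEq, reduceIte]
  refine ⟨?_, ?_, ?_, ?_, ?_, ?_, ?_, ?_, ?_, ?_, ?_, ?_, ?_, ?_, ?_⟩ <;> linarith

end

section

variable {G : Fin 3 → Fin 3 → Fin 3 → ℝ × ℝ × ℝ → ℝ} {U : Set (ℝ × ℝ × ℝ)} {p q : ℝ × ℝ × ℝ}

/-- If Weyl's tensor vanishes, then near each point there are three functions `φ a` with independent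
differentials that are affine, i.e. satisfy `∂ᵢ ∂ⱼ φ = ∑ l, Γ^l_{ij} ∂ₗ φ`, for a connection `Γ`
projectively equivalent to `G`: quotients of first components of parallel tractors. -/
lemma exists_affine_coordinates (hU : IsOpen U) (hG : ∀ l i j, ContDiffOn ℝ ∞ (G l i j) U)
    (htf : ∀ q ∈ U, TraceFreeAt G q)
    (hW : ∀ q ∈ U, ∀ l k i j, curv G l k i j q = projCurv G l k i j q) (hp : p ∈ U) :
    ∃ V : Set (ℝ × ℝ × ℝ), IsOpen V ∧ p ∈ V ∧ V ⊆ U ∧ ∃ φ ψ : Fin 3 → ℝ × ℝ × ℝ → ℝ,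
      (∀ a, ContDiffOn ℝ ∞ (φ a) V) ∧ (∀ a i, pd i (φ a) p = if i = a then 1 else 0) ∧
      ∀ q ∈ V, ∀ a i j, pd i (pd j (φ a)) q = ∑ l,
        (G l i j q - ((if l = i then ψ j q else 0) + if l = j then ψ i q else 0))
          * pd l (φ a) q := by
  obtain ⟨X, V₀, hV₀, hpV₀, hV₀U, hXp, hXs, hX⟩ := exists_fundamental_matrix hU
    (fun i => contDiffOn_tractor hU hG i)
    (fun q hq i j a b => tractor_compatible hU hG htf hW hq i j a b) hp
  have hX1 : ∀ q ∈ V₀, ∀ i b, pd i (X none b) q = X (some i) b q := fun q hq i b => by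
    simp [hX q hq, tractor, Fintype.sum_option]
  have hX2 : ∀ q ∈ V₀, ∀ i k b, pd i (X (some k) b) q
      = -schouten G i k q * X none b q + ∑ l, G l i k q * X (some l) b q := fun q hq i k b => by
    simp [hX q hq, tractor, Fintype.sum_option]
  have hV : IsOpen (V₀ ∩ X none none ⁻¹' {0}ᶜ) :=
    (hXs none none).continuousOn.isOpen_inter_preimage hV₀ isOpen_compl_singleton
  have hφ : ∀ a : Fin 3, ContDiffOn ℝ ∞ (fun q => X none (some a) q / X none none q)
      (V₀ ∩ X none none ⁻¹' {0}ᶜ) := fun a =>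
    ((hXs none (some a)).mono inter_subset_left).div ((hXs none none).mono inter_subset_left)
      fun q hq => hq.2
  have hpV : p ∈ V₀ ∩ X none none ⁻¹' {0}ᶜ := ⟨hpV₀, by simp [hXp]⟩
  generalize hVdef : V₀ ∩ X none none ⁻¹' {0}ᶜ = V at hV hφ hpV
  have hVV₀ : V ⊆ V₀ := hVdef ▸ inter_subset_left
  have hne : ∀ q ∈ V, X none none q ≠ 0 := fun q hq => by rw [← hVdef] at hq; exact hq.2
  generalize hφdef : (fun a q => X none (some a) q / X none none q : Fin 3 → ℝ × ℝ × ℝ → ℝ) = φ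
  replace hφ : ∀ a, ContDiffOn ℝ ∞ (φ a) V := hφdef ▸ hφ
  have hmul : ∀ q ∈ V, ∀ a, X none (some a) q = φ a q * X none none q := fun q hq a => by
    rw [← hφdef]; exact (div_mul_cancel₀ _ (hne q hq)).symm
  have hd : ∀ {f : ℝ × ℝ × ℝ → ℝ}, ContDiffOn ℝ ∞ f V → ∀ q ∈ V, DifferentiableAt ℝ f q :=
    fun hf q hq => (hf.contDiffAt (hV.mem_nhds hq)).differentiableAt (by simp)
  have hXV : ∀ a b, ContDiffOn ℝ ∞ (X a b) V := fun a b => (hXs a b).mono hVV₀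
  -- Leibniz' rule for the first and second derivatives of `σ = φ * σ₀`.
  have hleib : ∀ q ∈ V, ∀ a j, X (some j) (some a) q
      = φ a q * X (some j) none q + X none none q * pd j (φ a) q := fun q hq a j => by
    rw [← hX1 q (hVV₀ hq), ← hX1 q (hVV₀ hq), ← pd_mul j (hd (hφ a) q hq) (hd (hXV _ _) q hq)]
    refine pd_congr j ?_
    filter_upwards [hV.mem_nhds hq] with r hr using hmul r hr a
  have hleib2 : ∀ q ∈ V, ∀ a i j, pd i (X (some j) (some a)) q
      = φ a q * pd i (X (some j) none) q + X (some j) none q * pd i (φ a) q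
        + (X none none q * pd i (pd j (φ a)) q + pd j (φ a) q * X (some i) none q) :=
    fun q hq a i j => by
      have hdj := hd (contDiffOn_pd hV (hφ a) j) q hq
      have h1 := hd (hφ a) q hq
      rw [← hX1 q (hVV₀ hq) i none, ← pd_mul i h1 (hd (hXV _ _) q hq),
        ← pd_mul i (hd (hXV _ _) q hq) hdj,
        ← pd_add i (h1.fun_mul (hd (hXV _ _) q hq)) ((hd (hXV _ _) q hq).fun_mul hdj)]
      refine pd_congr i ?_
      filter_upwards [hV.mem_nhds hq] with r hr using hleib r hr a j
  refine ⟨V, hV, hpV, hVV₀.trans hV₀U, φ, fun j q => X (some j) none q / X none none q, hφ, ?_, ?_⟩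
  · intro a i
    have h1 := hleib p hpV a i
    have h2 := hmul p hpV a
    simp only [hXp, Option.some.injEq, reduceCtorEq, if_true, if_false] at h1 h2
    linarith
  · intro q hq a i j
    have h := hleib2 q hq a i j
    have h0 := hne q hq
    rw [hX2 q (hVV₀ hq), hX2 q (hVV₀ hq), hmul q hq] at h
    simp only [hleib q hq, Fin.sum_univ_three] at h
    simp only [sub_mul, add_mul, ite_mul, zero_mul, Finset.sum_sub_distrib, Finset.sum_add_distrib,
      Finset.sum_ite_eq', Finset.mem_univ, if_true]
    simp only [Fin.sum_univ_three]
    field_simp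
    linarith

end

/-- A smooth map with derivative the identity at `p` restricts to a local diffeomorphism; the domain
is shrunk to where the derivative is invertible, so that the inverse is smooth throughout. -/
lemma exists_openPartialHomeomorph {f : ℝ × ℝ × ℝ → ℝ × ℝ × ℝ} {V : Set (ℝ × ℝ × ℝ)}
    {p : ℝ × ℝ × ℝ} (hV : IsOpen V) (hp : p ∈ V) (hf : ContDiffOn ℝ ∞ f V)
    (hfp : fderiv ℝ f p = ContinuousLinearMap.id ℝ _) :
    ∃ Φ : OpenPartialHomeomorph (ℝ × ℝ × ℝ) (ℝ × ℝ × ℝ), p ∈ Φ.source ∧ Φ.source ⊆ V ∧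
      (Φ : ℝ × ℝ × ℝ → ℝ × ℝ × ℝ) = f ∧ ContDiffOn ℝ ∞ Φ.symm Φ.target := by
  have hd : ∀ q ∈ V, HasFDerivAt f (fderiv ℝ f q) q := fun q hq =>
    ((hf.contDiffAt (hV.mem_nhds hq)).differentiableAt (by simp)).hasFDerivAt
  have hW : IsOpen (V ∩ fderiv ℝ f ⁻¹' range
      ((↑) : ((ℝ × ℝ × ℝ) ≃L[ℝ] (ℝ × ℝ × ℝ)) → ℝ × ℝ × ℝ →L[ℝ] ℝ × ℝ × ℝ)) :=
    (hf.fderiv_of_isOpen hV (m := ∞) (by simp)).continuousOn.isOpen_inter_preimage hV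
      ContinuousLinearEquiv.isOpen
  have hfp' : HasFDerivAt f
      (ContinuousLinearEquiv.refl ℝ (ℝ × ℝ × ℝ) : ℝ × ℝ × ℝ →L[ℝ] ℝ × ℝ × ℝ) p := by
    have := hd p hp
    rwa [hfp] at this
  have hfpc := hf.contDiffAt (hV.mem_nhds hp)
  refine ⟨(hfpc.toOpenPartialHomeomorph f hfp' (by simp)).restrOpen _ hW, ?_, ?_, rfl, ?_⟩
  · exact ⟨hfpc.mem_toOpenPartialHomeomorph_source hfp' (by simp), hp,
      ContinuousLinearEquiv.refl ℝ _, hfp.symm⟩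
  · exact fun q hq => hq.2.1
  · intro y hy
    have hx := OpenPartialHomeomorph.map_target _ hy
    obtain ⟨e, he⟩ := hx.2.2
    refine (OpenPartialHomeomorph.contDiffAt_symm (f₀' := e) _ hy ?_
      (hf.contDiffAt (hV.mem_nhds hx.2.1))).contDiffWithinAt
    rw [he]
    exact hd _ hx.2.1

theorem System.FifteenConditions.linearizableAt {S : System} {U : Set (ℝ × ℝ × ℝ)}
    {p : ℝ × ℝ × ℝ} (hU : IsOpen U) (hS : S.SmoothOn U)
    (h : ∀ q ∈ U, S.FifteenConditions q) (hp : p ∈ U) : S.LinearizableAt U p := by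
  have hG := hS.christoffel
  have hW : ∀ q ∈ U, ∀ l k i j, curv S.christoffel l k i j q = projCurv S.christoffel l k i j q :=
    fun q hq => (h q hq).curv_eq (hS.traceFreeAt hU hq)
      (Eventually.of_forall S.isRepresentedBy_christoffel)
      fun l i j => ((hG l i j).contDiffAt (hU.mem_nhds hq)).differentiableAt (by simp)
  obtain ⟨V, hV, hpV, hVU, φ, ψ, hφ, hφp, hφ2⟩ := exists_affine_coordinates hU hG
    (fun q hq => hS.traceFreeAt hU hq) hW hp
  have hcoord : ∀ a, (fun t => coord a (φ 0 t, φ 1 t, φ 2 t)) = φ a := fun a => by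
    fin_cases a <;> rfl
  have hf : ContDiffOn ℝ ∞ (fun t => (φ 0 t, φ 1 t, φ 2 t)) V :=
    (hφ 0).prodMk ((hφ 1).prodMk (hφ 2))
  have hd1 := fun q (hq : q ∈ V) a j => pd_coord_comp hV hf hq a j
  have hd2 := fun q (hq : q ∈ V) a i j => pd_pd_coord_comp hV hf hq a i j
  simp only [hcoord] at hd1 hd2
  obtain ⟨Φ, hpΦ, hΦV, hΦf, hΨ⟩ := exists_openPartialHomeomorph hV hpV hf (by
    refine ContinuousLinearMap.ext fun ξ => ?_
    have : ∀ j, fderiv ℝ (fun t => (φ 0 t, φ 1 t, φ 2 t)) p (basisVec j) = basisVec j := fun j =>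
      ext_coord fun a => by
        rw [← hd1 p hpV, hφp, coord_basisVec]
        simp only [eq_comm]
    rw [eq_sum_coord ξ]
    simp only [map_sum, map_smul, this]
    rfl)
  have hΦ : ContDiffOn ℝ ∞ Φ Φ.source := hΦf ▸ hf.mono hΦV
  have hrep := fun q => (S.isRepresentedBy_christoffel q).projective_change ψ
  have hsymm : ∀ q l i j, S.christoffel l i j q
      - ((if l = i then ψ j q else 0) + if l = j then ψ i q else 0)
      = S.christoffel l j i q - ((if l = j then ψ i q else 0) + if l = i then ψ j q else 0) :=
    fun q l i j => by rw [S.christoffel_symm, add_comm]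
  refine ⟨Φ, hpΦ, hΦV.trans hVU, hΦ, hΨ, S.mapsToFree_of_quadratic hΦ
    (fun q hq => fderiv_injective hΦ hΨ hq) (fun q hq ξ => ?_)
    (fun q _ a b => ((hrep q).rhs_eq (hsymm q) a b).1)
    (fun q _ a b => ((hrep q).rhs_eq (hsymm q) a b).2)⟩
  have hexp : ∀ a, coord a (fderiv ℝ (fderiv ℝ Φ) q ξ ξ)
      = ∑ i, ∑ j, coord i ξ * coord j ξ * CubicODE.pd i (CubicODE.pd j (φ a)) q := fun a => by
    conv_lhs => rw [eq_sum_coord ξ]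
    simp only [map_sum, map_smul, sum_apply, smul_apply, hΦf, hd2 q (hΦV hq), smul_eq_mul,
      Finset.mul_sum]
    rw [Finset.sum_comm]
    exact Finset.sum_congr rfl fun i _ => Finset.sum_congr rfl fun j _ => by ring
  refine ext_coord fun a => ?_
  rw [hexp, quad]
  simp only [map_sum, map_smul, hΦf, ← hd1 q (hΦV hq), hφ2 q (hΦV hq), smul_eq_mul]
  simp only [Finset.mul_sum, Finset.sum_mul]
  symm
  rw [Finset.sum_comm]
  refine Finset.sum_congr rfl fun i _ => ?_
  rw [Finset.sum_comm]
  exact Finset.sum_congr rfl fun l _ => Finset.sum_congr rfl fun j _ => by ring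

end CubicODE

theorem theorem2 (S : CubicODE.System) (U : Set (ℝ × ℝ × ℝ)) (hU : IsOpen U)
    (hS : S.SmoothOn U) :
    (∀ p ∈ U, S.LinearizableAt U p) ↔ (∀ p ∈ U, S.FifteenConditions p) := by
  exact ⟨fun h p hp => (h p hp).fifteenConditions,
    fun h _ hp => CubicODE.System.FifteenConditions.linearizableAt hU hS h hp⟩
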